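/- There is an absolute constant $C>0$ such that the following holds for all $k,d\in\mathbb N$ with $1\le k\le\sqrt d$, all $\epsilon\in(0,1/2)$ and all $c\in(0,1)$. For $\beta\in\mathbb R^d$ and $\sigma>0$ let $\mathcal G(\beta,\sigma)$ be the distribution on $\mathbb R^{d+1}$ of $(X,y)$, where $X\sim N(0,\mathrm{Id}_d)$, $y=\langle X,\beta\rangle+\eta$, and $\eta\sim N(0,\sigma^2)$ is independent of $X$. A statistical query with tolerance $\tau>0$ is a measurable function $f:\mathbb R^{d+1}\to[-1,1]$; a STAT oracle for a distribution $\mathcal D$ answers it with a value $v$ such that $|v-\mathbb E_{\mathcal D}f|\le\tau$. An SQ algorithm accesses $\mathcal D$ only by asking adaptively chosen statistical queries, with tolerances of its choice, to a STAT oracle for $\mathcal D$; it may be randomised and is not computationally restricted otherwise. There exist a set $\mathcal B\subset\mathbb R^d$ of $k$-sparse vectors (at most $k$ nonzero coordinates) of Euclidean norm at most $1$, a number $\sigma\in[0.99,1]$, and for each $\beta^*\in\mathcal B$ a probability distribution $\mathcal Q_{\beta^*}$ on $\mathbb R^{d+1}$, such that, with $\mathcal D_{\beta^*}=(1-\epsilon)\,\mathcal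 G(\beta^*,\sigma)+\epsilon\,\mathcal Q_{\beta^*}$, the following is true. Let $\mathcal A$ be an SQ algorithm that, for every $\beta^*\in\mathcal B$ and every STAT oracle for $\mathcal D_{\beta^*}$, outputs with probability at least $2/3$ over its internal randomness (in particular, always) a vector $\hat\beta\in\mathbb R^d$ with $\|\beta^*-\hat\beta\|\le10^{-5}$. Then for some $\beta^*\in\mathcal B$ and some STAT oracle for $\mathcal D_{\beta^*}$, with positive probability $\mathcal A$ either - makes at least $d^{\,ck^c/8}\cdot k^{-2+2c}$ queries, or - makes at least one query with tolerance smaller than $k^{-1+c}\,e^{C/\epsilon^2}$. -/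

import Mathlib

open MeasureTheory ProbabilityTheory

namespace RobustSparseSQ

/-- A vector is `k`-sparse if it has at most `k` nonzero coordinates. -/
def IsSparse {d : ℕ} (k : ℕ) (v : EuclideanSpace ℝ (Fin d)) : Prop :=
  {i : Fin d | v i ≠ 0}.ncard ≤ k

/-- The law of `(X, y)` on `ℝ^d × ℝ`, where `X ∼ N(0, Id)`, `y = ⟨X, β⟩ + η` and
`η ∼ N(0, σ²)` is independent of `X`. -/
noncomputable def gaussianRegression {d : ℕ} (β : EuclideanSpace ℝ (Fin d)) (σ : ℝ) :
    Measure (EuclideanSpace ℝ (Fin d) × ℝ) :=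
  ((stdGaussian (EuclideanSpace ℝ (Fin d))).prod (gaussianReal 0 (Real.toNNReal (σ ^ 2)))).map
    (fun p => (p.1, inner ℝ p.1 β + p.2))

/-- The mixture `(1 - ε) P + ε Q` of two measures (for `0 ≤ ε ≤ 1`). -/
noncomputable def mixture {Z : Type*} [MeasurableSpace Z] (ε : ℝ) (P Q : Measure Z) : Measure Z :=
  ENNReal.ofReal (1 - ε) • P + ENNReal.ofReal ε • Q

/-- A statistical query: a measurable function with values in `[-1, 1]`, together with the
tolerance `τ > 0` with which it is asked. -/
structure SQQuery (Z : Type*) [MeasurableSpace Z] where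
  f : Z → ℝ
  measurable_f : Measurable f
  f_mem : ∀ z, f z ∈ Set.Icc (-1 : ℝ) 1
  tol : ℝ
  tol_pos : 0 < tol

/-- `O` is a STAT oracle for the distribution `D`: every query is answered up to an additive error
of at most its tolerance. -/
def IsSTATOracle {Z : Type*} [MeasurableSpace Z] (D : Measure Z) (O : SQQuery Z → ℝ) : Prop :=
  ∀ q : SQQuery Z, |O q - ∫ z, q.f z ∂D| ≤ q.tol

/-- A deterministic adaptive SQ algorithm, as a decision tree: it either stops with an output, or
asks a query and continues in a way that depends on the answer. No computational restriction is
imposed between the queries. -/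
inductive SQAlgorithm (Z : Type*) [MeasurableSpace Z] (Out : Type*) where
  | output (b : Out) : SQAlgorithm Z Out
  | query (q : SQQuery Z) (next : ℝ → SQAlgorithm Z Out) : SQAlgorithm Z Out

/-- The output of the run of an SQ algorithm against an oracle. -/
noncomputable def SQAlgorithm.result {Z : Type*} [MeasurableSpace Z] {Out : Type*}
    (O : SQQuery Z → ℝ) : SQAlgorithm Z Out → Out
  | .output b => b
  | .query q next => (next (O q)).result O

/-- The list of the queries made in the run of an SQ algorithm against an oracle. -/
noncomputable def SQAlgorithm.queries {Z : Type*} [MeasurableSpace Z] {Out : Type*}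
    (O : SQQuery Z → ℝ) : SQAlgorithm Z Out → List (SQQuery Z)
  | .output _ => []
  | .query q next => q :: (next (O q)).queries O

/-- A randomised SQ algorithm (a family `A ω` of deterministic ones, indexed by a random seed
`ω ∼ P`) that, with access to any STAT oracle for `D`, outputs with probability at least `2/3` a
vector at distance at most `δ` from `β`. -/
def Estimates {Z : Type*} [MeasurableSpace Z] {E : Type*} [NormedAddCommGroup E]
    {Ω : Type*} [MeasurableSpace Ω] (P : Measure Ω) (A : Ω → SQAlgorithm Z E)
    (D : Measure Z) (β : E) (δ : ℝ) : Prop :=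
  ∀ O : SQQuery Z → ℝ, IsSTATOracle D O →
    ∃ S : Set Ω, MeasurableSet S ∧ 2 / 3 ≤ P S ∧ ∀ ω ∈ S, ‖β - (A ω).result O‖ ≤ δ

end RobustSparseSQ

/-! The hard instances hide a unit vector `v` drawn from a large finite family of sparse, almost
orthogonal vectors: `β = α v` with `α² + σ² = 1`, so that `y` is standard normal and, given `y`, the
component `u = ⟨v, x⟩` is `N(αy, σ²)`. The outliers give `y` the density `w(y) = (1 + y²)/2` with
respect to `N(0, 1)` and shift `u` in the opposite direction, by exactly what is needed for the
conditional first moment of `u` to vanish in the mixture. Since `|y| ≤ w(y)`, the shift is at most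
`α/ε`, which keeps the chi-square size of the perturbation below `280 exp(1/ε²)`.

Relative to a reference density that ignores `v`, the perturbation `excess` is, for each fixed `y`,
a function of `u` orthogonal to `1` and to `u`. By the Mehler (Hermite) expansion, two such
functions in directions `v` and `v'` then have correlation of order `⟨v, v'⟩²` rather than `⟨v, v'⟩`
(`abs_integral_inner_mul_inner_le`). By Cauchy–Schwarz, a bounded query can therefore correlate
noticeably with only a few directions (`card_mul_sub_le`).

An oracle that gives the reference answer whenever it is allowed to thus reveals little: each query
rules out at most `M` directions, and an output is close to at most one of the rest. Averaging over
the seed gives `2/3 |V| ≤ 1 + N M` (`two_thirds_card_le`). Reed–Solomon codes, with codewords turned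
into indicators of graphs, supply enough directions (`exists_sparse_family`). -/

namespace RobustSparseSQ

/-! ### Gaussian density ratios on the line -/

/-- The density of `N(m, σ²)` with respect to `N(0, 1)`. -/
noncomputable def gaussianRatio (m σ u : ℝ) : ℝ :=
  σ⁻¹ * Real.exp (u ^ 2 / 2 - (u - m) ^ 2 / (2 * σ ^ 2))

lemma gaussianRatio_nonneg {m σ u : ℝ} (hσ : 0 < σ) : 0 ≤ gaussianRatio m σ u := by
  unfold gaussianRatio; positivity

lemma gaussianRatio_one (m u : ℝ) : gaussianRatio m 1 u = Real.exp (m * u - m ^ 2 / 2) := by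
  unfold gaussianRatio
  rw [inv_one, one_mul]
  congr 1
  ring

@[fun_prop]
lemma measurable_gaussianRatio {α : Type*} [MeasurableSpace α] {m u : α → ℝ} {σ : ℝ}
    (hm : Measurable m) (hu : Measurable u) :
    Measurable fun x => gaussianRatio (m x) σ (u x) := by
  unfold gaussianRatio; fun_prop

lemma gaussianReal_eq_withDensity {m σ : ℝ} (hσ : 0 < σ) :
    gaussianReal m (Real.toNNReal (σ ^ 2)) =
      (gaussianReal 0 1).withDensity (fun u => ENNReal.ofReal (gaussianRatio m σ u)) := by
  have h0 : Real.toNNReal (σ ^ 2) ≠ 0 := by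
    rw [Ne, Real.toNNReal_eq_zero, not_le]; positivity
  rw [gaussianReal_of_var_ne_zero m h0, gaussianReal_of_var_ne_zero 0 one_ne_zero,
    ← withDensity_mul _ (measurable_gaussianPDF 0 1) (by fun_prop)]
  congr 1
  ext u
  rw [Pi.mul_apply, gaussianPDF, gaussianPDF, ← ENNReal.ofReal_mul (gaussianPDFReal_nonneg _ _ _)]
  congr 1
  rw [gaussianPDFReal, gaussianPDFReal, gaussianRatio, Real.coe_toNNReal _ (by positivity)]
  have h1 : Real.sqrt (2 * Real.pi * σ ^ 2) = Real.sqrt (2 * Real.pi) * σ := by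
    rw [Real.sqrt_mul (by positivity), Real.sqrt_sq hσ.le]
  rw [h1, mul_inv]
  simp only [NNReal.coe_one, mul_one, sub_zero]
  have : Real.exp (-(u - m) ^ 2 / (2 * σ ^ 2)) =
    Real.exp (-u ^ 2 / 2) * Real.exp (u ^ 2 / 2 - (u - m) ^ 2 / (2 * σ ^ 2)) := by
    rw [← Real.exp_add]; congr 1; ring
  rw [this]; ring

lemma integral_gaussianRatio_mul {m σ : ℝ} (hσ : 0 < σ) (f : ℝ → ℝ) :
    ∫ u, gaussianRatio m σ u * f u ∂(gaussianReal 0 1) =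
      ∫ u, f u ∂(gaussianReal m (Real.toNNReal (σ ^ 2))) := by
  rw [gaussianReal_eq_withDensity hσ, integral_withDensity_eq_integral_toReal_smul (by fun_prop)
    (by simp)]
  simp [ENNReal.toReal_ofReal (gaussianRatio_nonneg hσ)]

lemma integrable_gaussianRatio_mul {m σ : ℝ} (hσ : 0 < σ) {f : ℝ → ℝ}
    (hf : Integrable f (gaussianReal m (Real.toNNReal (σ ^ 2)))) :
    Integrable (fun u => gaussianRatio m σ u * f u) (gaussianReal 0 1) := by
  rw [gaussianReal_eq_withDensity hσ,
    integrable_withDensity_iff_integrable_smul' (by fun_prop) (by simp)] at hf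
  simpa [ENNReal.toReal_ofReal (gaussianRatio_nonneg hσ)] using hf

lemma integral_gaussianRatio {m σ : ℝ} (hσ : 0 < σ) :
    ∫ u, gaussianRatio m σ u ∂(gaussianReal 0 1) = 1 := by
  simpa using integral_gaussianRatio_mul (m := m) hσ (fun _ => 1)

lemma integrable_gaussianRatio {m σ : ℝ} (hσ : 0 < σ) :
    Integrable (gaussianRatio m σ) (gaussianReal 0 1) := by
  simpa using integrable_gaussianRatio_mul (m := m) hσ (integrable_const (1 : ℝ))

lemma integral_mul_gaussianRatio {m σ : ℝ} (hσ : 0 < σ) :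
    ∫ u, u * gaussianRatio m σ u ∂(gaussianReal 0 1) = m := by
  have := integral_gaussianRatio_mul (m := m) hσ (fun u => u)
  rw [integral_id_gaussianReal] at this
  simpa only [mul_comm] using this

lemma integrable_mul_gaussianRatio {m σ : ℝ} (hσ : 0 < σ) :
    Integrable (fun u => u * gaussianRatio m σ u) (gaussianReal 0 1) := by
  have h : Integrable (fun u : ℝ => u) (gaussianReal m (Real.toNNReal (σ ^ 2))) :=
    (memLp_id_gaussianReal 1).integrable (by simp)
  simpa [mul_comm] using integrable_gaussianRatio_mul hσ h

lemma integral_exp_mul_gaussianReal (t : ℝ) :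
    ∫ u, Real.exp (t * u) ∂(gaussianReal 0 1) = Real.exp (t ^ 2 / 2) := by
  have := congrFun (mgf_id_gaussianReal (μ := 0) (v := 1)) t
  simpa [mgf] using this

lemma memLp_gaussianRatio_one (m : ℝ) :
    MemLp (gaussianRatio m 1) 2 (gaussianReal 0 1) := by
  rw [memLp_two_iff_integrable_sq (by fun_prop)]
  have := (integrable_exp_mul_gaussianReal (μ := 0) (v := 1) (2 * m)).const_mul (Real.exp (-m ^ 2))
  refine this.congr (.of_forall fun u => ?_)
  simp only [gaussianRatio_one]
  rw [← Real.exp_add, ← Real.exp_nat_mul]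
  congr 1
  push_cast
  ring

/-! ### Density of the exponentials in `L²(N(0, 1))` -/

/-- The exponentials `u ↦ exp (m u - m² / 2)` as elements of `L²(N(0, 1))`. -/
noncomputable def expLp (m : ℝ) : Lp ℝ 2 (gaussianReal 0 1) :=
  (memLp_gaussianRatio_one m).toLp _

/-- If `f` is orthogonal to every exponential, then the measures with densities `f⁺` and `f⁻` have
the same moment generating function, finite on all of `ℝ`. Such a function determines the measure,
so `f⁺ = f⁻` and `f = 0`. -/
lemma span_expLp_dense :
    (Submodule.span ℝ (Set.range expLp)).topologicalClosure = ⊤ := by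
  rw [Submodule.topologicalClosure_eq_top_iff, Submodule.eq_bot_iff]
  intro f hf
  have horth : ∀ a : ℝ, ∫ u, Real.exp (a * u) * f u ∂(gaussianReal 0 1) = 0 := by
    intro a
    have h := hf (expLp a) (Submodule.subset_span ⟨a, rfl⟩)
    rw [L2.inner_def] at h
    have h2 : ∫ u, inner ℝ (expLp a u) (f u) ∂(gaussianReal 0 1)
        = Real.exp (-(a ^ 2) / 2) * ∫ u, Real.exp (a * u) * f u ∂(gaussianReal 0 1) := by
      rw [← integral_const_mul]
      refine integral_congr_ae ?_
      filter_upwards [(memLp_gaussianRatio_one a).coeFn_toLp] with u hu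
      rw [expLp, hu, gaussianRatio_one, RCLike.inner_apply, conj_trivial, ← mul_assoc,
        ← Real.exp_add, mul_comm]
      congr 2
      ring
    rw [h2] at h
    exact (mul_eq_zero.1 h).resolve_left (Real.exp_ne_zero _)
  have hint : ∀ a : ℝ, Integrable (fun u => Real.exp (a * u) * f u) (gaussianReal 0 1) := by
    intro a
    refine MemLp.integrable_mul (p := 2) (q := 2) ?_ (Lp.memLp f)
    rw [memLp_two_iff_integrable_sq (by fun_prop)]
    refine (integrable_exp_mul_gaussianReal (μ := 0) (v := 1) (2 * a)).congr
      (.of_forall fun u => ?_)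
    simp only
    rw [← Real.exp_nat_mul]; congr 1; push_cast; ring
  have hintf : Integrable f (gaussianReal 0 1) := by simpa using hint 0
  have hmeas : AEMeasurable f (gaussianReal 0 1) := hintf.aemeasurable
  -- `ENNReal.ofReal` truncates at zero, so `ν f` has density `f⁺` and `ν (-f)` has density `f⁻`.
  let ν (g : ℝ → ℝ) : Measure ℝ := (gaussianReal 0 1).withDensity fun u => ENNReal.ofReal (g u)
  have hexp : ∀ (g : ℝ → ℝ), AEMeasurable g (gaussianReal 0 1) → ∀ a : ℝ,
      Integrable (fun u => Real.exp (a * u) * g u) (gaussianReal 0 1) →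
      Integrable (fun u => Real.exp (a * u)) (ν g) ∧
      ∫ u, Real.exp (a * u) ∂(ν g) = ∫ u, Real.exp (a * u) * max (g u) 0 ∂(gaussianReal 0 1) := by
    intro g hg a hga
    constructor
    · rw [integrable_withDensity_iff_integrable_smul₀' hg.ennreal_ofReal (by simp)]
      refine (hga.sup (integrable_zero _ _ _)).congr (.of_forall fun u => ?_)
      simp only [Pi.sup_apply, smul_eq_mul, ENNReal.toReal_ofReal']
      rw [mul_comm (max _ _), mul_max_of_nonneg _ _ (Real.exp_nonneg _), mul_zero,
        Pi.zero_apply]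
    · rw [integral_withDensity_eq_integral_toReal_smul₀ hg.ennreal_ofReal (by simp)]
      refine integral_congr_ae (.of_forall fun u => ?_)
      simp only [smul_eq_mul, ENNReal.toReal_ofReal', mul_comm]
  have hint' : ∀ a : ℝ, Integrable (fun u => Real.exp (a * u) * (-f u)) (gaussianReal 0 1) :=
    fun a => by simpa using (hint a).neg
  have hmgf : mgf id (ν f) = mgf id (ν fun u => -f u) := by
    ext a
    simp only [mgf, id]
    rw [(hexp f hmeas a (hint a)).2, (hexp (fun u => -f u) hmeas.neg a (hint' a)).2, ← sub_eq_zero,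
      ← integral_sub]
    · refine Eq.trans (integral_congr_ae ?_) (horth a)
      refine .of_forall fun u => ?_
      simp only
      rw [← mul_sub]
      congr 1
      rcases le_total (f u) 0 with h | h
      · simp [h]
      · simp [h]
    · refine ((hint a).sup (integrable_zero _ _ _)).congr (.of_forall fun u => ?_)
      simp [mul_max_of_nonneg _ _ (Real.exp_nonneg (a * u))]
    · refine ((hint' a).sup (integrable_zero _ _ _)).congr (.of_forall fun u => ?_)
      simp [mul_max_of_nonneg _ _ (Real.exp_nonneg (a * u))]
  have fin1 : IsFiniteMeasure (ν f) := isFiniteMeasure_withDensity_ofReal hintf.2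
  have fin2 : IsFiniteMeasure (ν fun u => -f u) := isFiniteMeasure_withDensity_ofReal hintf.neg.2
  have hset : integrableExpSet id (ν f) = Set.univ := by
    ext a
    simpa [integrableExpSet] using (hexp f hmeas a (hint a)).1
  have hzero : ν f = 0 ↔ (ν fun u => -f u) = 0 := by
    have h0 := congrFun hmgf 0
    simp only [mgf_zero'] at h0
    rw [← Measure.measure_univ_eq_zero, ← Measure.measure_univ_eq_zero,
      ← measureReal_eq_zero_iff, ← measureReal_eq_zero_iff, h0]
  -- Analytic continuation from the real axis. The strip of validity is the whole plane because
  -- every real exponential is integrable.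
  have hc : complexMGF id (ν f) = complexMGF id (ν fun u => -f u) := by
    ext z
    refine eqOn_complexMGF_of_mgf' hmgf hzero ?_
    simp [hset]
  have heq := Measure.ext_of_complexMGF_id_eq hc
  have hae := (withDensity_eq_iff hmeas.ennreal_ofReal hmeas.neg.ennreal_ofReal
    (by
      have := hintf.lintegral_lt_top
      exact this.ne)).1 heq
  rw [Lp.eq_zero_iff_ae_eq_zero]
  filter_upwards [hae] with u hu
  have hu' : ENNReal.ofReal (f u) = ENNReal.ofReal (-f u) := hu
  rcases lt_trichotomy (f u) 0 with h | h | h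
  · rw [ENNReal.ofReal_of_nonpos h.le] at hu'
    have := ENNReal.ofReal_eq_zero.1 hu'.symm
    linarith
  · exact h
  · rw [ENNReal.ofReal_of_nonpos (by linarith : -f u ≤ 0)] at hu'
    have := ENNReal.ofReal_eq_zero.1 hu'
    linarith

/-! ### Correlation of two one-dimensional projections -/

section Correlation

variable {E : Type*} [NormedAddCommGroup E] [InnerProductSpace ℝ E] [FiniteDimensional ℝ E]
  [MeasurableSpace E] [BorelSpace E]

lemma stdGaussian_map_inner (t : E) :
    (stdGaussian E).map (fun x => inner ℝ t x) =
      gaussianReal 0 (Real.toNNReal (‖t‖ ^ 2)) := by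
  have h := IsGaussian.map_eq_gaussianReal (μ := stdGaussian E) (innerSL ℝ t)
  rw [integral_strongDual_stdGaussian, variance_dual_stdGaussian, innerSL_apply_norm] at h
  exact h

lemma measurePreserving_inner {v : E} (hv : ‖v‖ = 1) :
    MeasurePreserving (fun x => inner ℝ v x) (stdGaussian E) (gaussianReal 0 1) :=
  ⟨by fun_prop, by rw [stdGaussian_map_inner, hv]; simp⟩

lemma integral_exp_inner_stdGaussian (t : E) :
    ∫ x, Real.exp (inner ℝ t x) ∂(stdGaussian E) = Real.exp (‖t‖ ^ 2 / 2) := by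
  have h := integral_map (μ := stdGaussian E) (φ := fun x => inner ℝ t x)
    (f := fun u : ℝ => Real.exp u) (by fun_prop) (by fun_prop)
  rw [← h, stdGaussian_map_inner]
  have := congrFun (mgf_id_gaussianReal (μ := 0) (v := Real.toNNReal (‖t‖ ^ 2))) 1
  simpa [mgf] using this

/-- Composition with the linear form `⟨v, ·⟩`, for a unit vector `v`. -/
noncomputable def compInner {v : E} (hv : ‖v‖ = 1) :
    Lp ℝ 2 (gaussianReal 0 1) →ₗᵢ[ℝ] Lp ℝ 2 (stdGaussian E) :=
  Lp.compMeasurePreservingₗᵢ ℝ _ (measurePreserving_inner hv)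

lemma coeFn_compInner {v : E} (hv : ‖v‖ = 1) (f : Lp ℝ 2 (gaussianReal 0 1)) :
    compInner hv f =ᵐ[stdGaussian E] fun x => f (inner ℝ v x) :=
  Lp.coeFn_compMeasurePreserving f (measurePreserving_inner hv)

lemma compInner_toLp {v : E} (hv : ‖v‖ = 1) {f : ℝ → ℝ} (hf : MemLp f 2 (gaussianReal 0 1)) :
    compInner hv (hf.toLp f) =ᵐ[stdGaussian E] fun x => f (inner ℝ v x) :=
  (coeFn_compInner hv _).trans
    ((measurePreserving_inner hv).quasiMeasurePreserving.ae_eq hf.coeFn_toLp)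

lemma inner_toLp_toLp {Z : Type*} [MeasurableSpace Z] {μ : Measure Z} {f g : Z → ℝ}
    (hf : MemLp f 2 μ) (hg : MemLp g 2 μ) :
    inner ℝ (hf.toLp f) (hg.toLp g) = ∫ z, f z * g z ∂μ := by
  rw [L2.inner_def]
  refine integral_congr_ae ?_
  filter_upwards [hf.coeFn_toLp, hg.coeFn_toLp] with z h1 h2
  rw [h1, h2, RCLike.inner_apply, conj_trivial, mul_comm]

lemma inner_compInner_toLp {v v' : E} (hv : ‖v‖ = 1) (hv' : ‖v'‖ = 1) {f g : ℝ → ℝ}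
    (hf : MemLp f 2 (gaussianReal 0 1)) (hg : MemLp g 2 (gaussianReal 0 1)) :
    inner ℝ (compInner hv (hf.toLp f)) (compInner hv' (hg.toLp g)) =
      ∫ x, f (inner ℝ v x) * g (inner ℝ v' x) ∂(stdGaussian E) := by
  rw [L2.inner_def]
  refine integral_congr_ae ?_
  filter_upwards [compInner_toLp hv hf, compInner_toLp hv' hg] with z h1 h2
  rw [h1, h2, RCLike.inner_apply, conj_trivial, mul_comm]

/-- The product of the two exponentials is a multiple of the exponential of the linear form of `a v
+ b v'`. In its Gaussian integral the square terms cancel the normalisations, so only the cross term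
survives. This is the generating-function form of the Mehler kernel. -/
lemma inner_compInner_expLp {v v' : E} (hv : ‖v‖ = 1) (hv' : ‖v'‖ = 1) (a b : ℝ) :
    inner ℝ (compInner hv (expLp a)) (compInner hv' (expLp b)) =
      Real.exp (inner ℝ v v' * (a * b)) := by
  rw [expLp, expLp, inner_compInner_toLp]
  simp_rw [gaussianRatio_one]
  have h : ∀ x : E, Real.exp (a * inner ℝ v x - a ^ 2 / 2) * Real.exp (b * inner ℝ v' x - b ^ 2 / 2)
      = Real.exp (-(a ^ 2 + b ^ 2) / 2) * Real.exp (inner ℝ (a • v + b • v') x) := by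
    intro x
    rw [← Real.exp_add, ← Real.exp_add, inner_add_left, real_inner_smul_left,
      real_inner_smul_left]
    congr 1; ring
  simp_rw [h]
  rw [integral_const_mul, integral_exp_inner_stdGaussian, ← Real.exp_add, norm_add_sq_real,
    norm_smul, norm_smul, hv, hv', real_inner_smul_left, real_inner_smul_right]
  congr 1
  simp only [Real.norm_eq_abs, mul_one, sq_abs]
  ring

lemma inner_expLp (a b : ℝ) : inner ℝ (expLp a) (expLp b) = Real.exp (a * b) := by
  rw [expLp, expLp, inner_toLp_toLp]
  simp_rw [gaussianRatio_one]
  have h : ∀ u : ℝ, Real.exp (a * u - a ^ 2 / 2) * Real.exp (b * u - b ^ 2 / 2)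
      = Real.exp (-(a ^ 2 + b ^ 2) / 2) * Real.exp ((a + b) * u) := by
    intro u
    rw [← Real.exp_add, ← Real.exp_add]
    congr 1; ring
  simp_rw [h]
  rw [integral_const_mul, integral_exp_mul_gaussianReal, ← Real.exp_add]
  congr 1; ring

/-- The identity function as an element of `L²(N(0, 1))`. -/
noncomputable def idLp : Lp ℝ 2 (gaussianReal 0 1) :=
  (memLp_id_gaussianReal (μ := 0) (v := 1) 2).toLp id

lemma inner_idLp_expLp (a : ℝ) : inner ℝ idLp (expLp a) = a := by
  rw [idLp, expLp]
  erw [inner_toLp_toLp]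
  exact integral_mul_gaussianRatio one_pos

/-- Multiplying the kernel by `ρ` shrinks the part of order at least two of its quadratic form by `ρ²`. -/
lemma abs_sum_exp_sub_le (s : Finset ℝ) (c : ℝ → ℝ) {ρ : ℝ} (hρ : |ρ| ≤ 1) :
    |∑ a ∈ s, ∑ b ∈ s, c a * c b * (Real.exp (ρ * (a * b)) - 1 - ρ * (a * b))| ≤
      ρ ^ 2 * ∑ a ∈ s, ∑ b ∈ s, c a * c b * (Real.exp (a * b) - 1 - a * b) := by
  -- The quadratic form is a power series in `t` starting at order two, whose coefficients are
  -- squares over factorials. Nonnegativity of these coefficients allows a term-by-term comparison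
  -- using `|ρ ^ (n + 2)| ≤ ρ ^ 2`.
  have hs : ∀ t : ℝ, HasSum
      (fun n : ℕ => t ^ (n + 2) * ((∑ a ∈ s, c a * a ^ (n + 2)) ^ 2 / ((n + 2).factorial : ℝ)))
      (∑ a ∈ s, ∑ b ∈ s, c a * c b * (Real.exp (t * (a * b)) - 1 - t * (a * b))) := by
    intro t
    have h1 : ∀ z : ℝ, HasSum (fun n : ℕ => z ^ (n + 2) / ((n + 2).factorial : ℝ))
        (Real.exp z - 1 - z) := by
      intro z
      have h := NormedSpace.exp_series_hasSum_exp' (𝕂 := ℝ) z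
      rw [← Real.exp_eq_exp_ℝ] at h
      have h2 := (hasSum_nat_add_iff' 2).2 h
      simp only [Finset.sum_range_succ, Finset.sum_range_zero, smul_eq_mul] at h2
      have e : Real.exp z - (0 + ((Nat.factorial 0 : ℕ) : ℝ)⁻¹ * z ^ 0 +
          ((Nat.factorial 1 : ℕ) : ℝ)⁻¹ * z ^ 1) = Real.exp z - 1 - z := by
        simp only [Nat.factorial, Nat.cast_one]; ring
      rw [e] at h2
      simpa only [div_eq_inv_mul] using h2
    have h2 := hasSum_sum (s := s) fun a _ => hasSum_sum (s := s) fun b _ =>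
      (h1 (t * (a * b))).mul_left (c a * c b)
    refine (funext fun n => ?_ : (fun n : ℕ => _) = _) ▸ h2
    symm
    rw [sq (∑ a ∈ s, _), Finset.sum_mul_sum, Finset.sum_div, Finset.mul_sum]
    refine Finset.sum_congr rfl fun a _ => ?_
    rw [Finset.sum_div, Finset.mul_sum]
    refine Finset.sum_congr rfl fun b _ => ?_
    rw [mul_pow, mul_pow]
    ring
  have h1 := hs 1
  simp only [one_pow, one_mul] at h1
  have hb : ∀ n : ℕ, |ρ ^ (n + 2)| ≤ ρ ^ 2 := by
    intro n
    rw [pow_add, abs_mul, abs_pow, abs_of_nonneg (sq_nonneg ρ)]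
    exact mul_le_of_le_one_left (sq_nonneg ρ) (pow_le_one₀ (abs_nonneg ρ) hρ)
  have hnn : ∀ n : ℕ, 0 ≤ (∑ a ∈ s, c a * a ^ (n + 2)) ^ 2 / ((n + 2).factorial : ℝ) :=
    fun n => by positivity
  rw [abs_le]
  constructor
  · rw [← neg_mul]
    refine hasSum_le (fun n => ?_) (h1.mul_left (-(ρ ^ 2))) (hs ρ)
    exact mul_le_mul_of_nonneg_right (abs_le.1 (hb n)).1 (hnn n)
  · refine hasSum_le (fun n => ?_) (hs ρ) (h1.mul_left (ρ ^ 2))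
    exact mul_le_mul_of_nonneg_right (abs_le.1 (hb n)).2 (hnn n)

/-- The subtracted terms are the contributions of the constant and linear Hermite components of `f`.
Both sides are continuous in `f`, so it suffices to treat finite combinations of exponentials, for
which the inequality is `abs_sum_exp_sub_le`. -/
lemma abs_inner_compInner_sub_le {v v' : E} (hv : ‖v‖ = 1) (hv' : ‖v'‖ = 1)
    (f : Lp ℝ 2 (gaussianReal 0 1)) :
    |inner ℝ (compInner hv f) (compInner hv' f) - inner ℝ (expLp 0) f ^ 2
        - inner ℝ v v' * inner ℝ idLp f ^ 2| ≤
      inner ℝ v v' ^ 2 * (inner ℝ f f - inner ℝ (expLp 0) f ^ 2 - inner ℝ idLp f ^ 2) := by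
  have hρ : |inner ℝ v v'| ≤ 1 := by
    simpa [hv, hv'] using abs_real_inner_le_norm v v'
  have hd : Dense (Submodule.span ℝ (Set.range expLp) : Set (Lp ℝ 2 (gaussianReal 0 1))) :=
    (Submodule.dense_iff_topologicalClosure_eq_top).2 span_expLp_dense
  have hclosed : IsClosed {f : Lp ℝ 2 (gaussianReal 0 1) |
    |inner ℝ (compInner hv f) (compInner hv' f) - inner ℝ (expLp 0) f ^ 2
        - inner ℝ v v' * inner ℝ idLp f ^ 2| ≤
      inner ℝ v v' ^ 2 * (inner ℝ f f - inner ℝ (expLp 0) f ^ 2 - inner ℝ idLp f ^ 2)} := by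
    have c1 := (compInner hv).continuous
    have c2 := (compInner hv').continuous
    refine isClosed_le ?_ ?_ <;> fun_prop
  refine hclosed.closure_subset_iff.2 ?_ (hd f)
  rintro _ hg
  obtain ⟨c, rfl⟩ := Finsupp.mem_span_range_iff_exists_finsupp.1 hg
  have key := abs_sum_exp_sub_le c.support c hρ
  set F := c.sum fun a r => r • expLp a with hF
  have hF' : F = ∑ a ∈ c.support, c a • expLp a := hF
  have e1 : inner ℝ (compInner hv F) (compInner hv' F) =
      ∑ a ∈ c.support, ∑ b ∈ c.support, c a * c b * Real.exp (inner ℝ v v' * (a * b)) := by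
    simp only [hF', map_sum, map_smul, sum_inner, inner_sum, real_inner_smul_left,
      real_inner_smul_right, inner_compInner_expLp, mul_assoc]
    exact Finset.sum_congr rfl fun a _ => Finset.sum_congr rfl fun b _ => by ring_nf
  have e2 : inner ℝ F F = ∑ a ∈ c.support, ∑ b ∈ c.support, c a * c b * Real.exp (a * b) := by
    simp only [hF', sum_inner, inner_sum, real_inner_smul_left, real_inner_smul_right,
      inner_expLp, mul_assoc]
    exact Finset.sum_congr rfl fun a _ => Finset.sum_congr rfl fun b _ => by ring_nf
  have e3 : inner ℝ (expLp 0) F ^ 2 = ∑ a ∈ c.support, ∑ b ∈ c.support, c a * c b := by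
    simp only [hF', inner_sum, real_inner_smul_right, inner_expLp, zero_mul, Real.exp_zero,
      mul_one]
    rw [sq, Finset.sum_mul_sum]
  have e4 : inner ℝ idLp F ^ 2 = ∑ a ∈ c.support, ∑ b ∈ c.support, c a * c b * (a * b) := by
    simp only [hF', inner_sum, real_inner_smul_right, inner_idLp_expLp]
    rw [sq, Finset.sum_mul_sum]
    exact Finset.sum_congr rfl fun a _ => Finset.sum_congr rfl fun b _ => by ring
  rw [Set.mem_ofPred_eq]
  rw [e1, e2, e3, e4]
  simpa only [mul_sub, Finset.sum_sub_distrib, Finset.mul_sum, mul_one, mul_left_comm] using key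

/-- Two one-dimensional projections with correlation `ρ` of a function that is orthogonal to the
affine functions have correlation at most `ρ²`. -/
theorem abs_integral_inner_mul_inner_le {v v' : E} (hv : ‖v‖ = 1) (hv' : ‖v'‖ = 1)
    {f : ℝ → ℝ} (hf : MemLp f 2 (gaussianReal 0 1))
    (h0 : ∫ u, f u ∂(gaussianReal 0 1) = 0) (h1 : ∫ u, u * f u ∂(gaussianReal 0 1) = 0) :
    |∫ x, f (inner ℝ v x) * f (inner ℝ v' x) ∂(stdGaussian E)| ≤
      inner ℝ v v' ^ 2 * ∫ u, f u ^ 2 ∂(gaussianReal 0 1) := by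
  have h := abs_inner_compInner_sub_le hv hv' (hf.toLp f)
  have e0 : inner ℝ (expLp 0) (hf.toLp f) = 0 := by
    rw [expLp, inner_toLp_toLp]
    simpa [gaussianRatio_one] using h0
  have e1 : inner ℝ idLp (hf.toLp f) = 0 := by
    rw [idLp]
    erw [inner_toLp_toLp]
    exact h1
  rw [e0, e1, inner_compInner_toLp, inner_toLp_toLp] at h
  simpa [sq] using h

end Correlation

/-! ### Lazy oracles and the counting argument -/

section Oracle

variable {Z : Type*} [MeasurableSpace Z]

open Classical in
/-- The STAT oracle for `D` that gives the reference answer whenever this is allowed. -/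
noncomputable def lazyOracle (ref : SQQuery Z → ℝ) (D : Measure Z) (q : SQQuery Z) : ℝ :=
  if |ref q - ∫ z, q.f z ∂D| ≤ q.tol then ref q else ∫ z, q.f z ∂D

lemma isSTATOracle_lazyOracle (ref : SQQuery Z → ℝ) (D : Measure Z) :
    IsSTATOracle D (lazyOracle ref D) := by
  intro q
  unfold lazyOracle
  split_ifs with h
  · exact h
  · simpa using q.tol_pos.le

variable {E : Type*} [NormedAddCommGroup E]

open Classical in
/-- A deterministic algorithm with few queries of large tolerance succeeds against the lazy
oracles for few of the hidden parameters. -/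
lemma card_success_le (B : Finset E) (D : E → Measure Z) (ref : SQQuery Z → ℝ) {δ τ M : ℝ}
    (hsep : ∀ β ∈ B, ∀ β' ∈ B, β ≠ β' → 2 * δ < ‖β - β'‖)
    (hM : ∀ q : SQQuery Z, τ ≤ q.tol →
      ((B.filter fun β => q.tol < |ref q - ∫ z, q.f z ∂(D β)|).card : ℝ) ≤ M)
    (hM0 : 0 ≤ M) (T : SQAlgorithm Z E) (n : ℕ) :
    ((B.filter fun β => (T.queries (lazyOracle ref (D β))).length ≤ n ∧
      (∀ q ∈ T.queries (lazyOracle ref (D β)), τ ≤ q.tol) ∧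
      ‖β - T.result (lazyOracle ref (D β))‖ ≤ δ).card : ℝ) ≤ 1 + n * M := by
  induction T generalizing n with
  | output b =>
    have h : (B.filter fun β => ((SQAlgorithm.output b : SQAlgorithm Z E).queries
        (lazyOracle ref (D β))).length ≤ n ∧
        (∀ q ∈ (SQAlgorithm.output b : SQAlgorithm Z E).queries (lazyOracle ref (D β)),
          τ ≤ q.tol) ∧
        ‖β - (SQAlgorithm.output b : SQAlgorithm Z E).result (lazyOracle ref (D β))‖ ≤ δ).card
        ≤ 1 := by
      refine Finset.card_le_one.2 fun β hβ β' hβ' => ?_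
      rw [Finset.mem_filter] at hβ hβ'
      by_contra hne
      have h1 := hsep β hβ.1 β' hβ'.1 hne
      have h2 : ‖β - b‖ ≤ δ := hβ.2.2.2
      have h3 : ‖β' - b‖ ≤ δ := hβ'.2.2.2
      have h4 := norm_sub_le_norm_sub_add_norm_sub β b β'
      rw [norm_sub_rev b β'] at h4
      linarith
    have : (0 : ℝ) ≤ n * M := by positivity
    have h' := (Nat.cast_le (α := ℝ)).2 h
    push_cast at h'
    linarith
  | query q next ih =>
    rcases n with _ | m
    · rw [Finset.filter_false_of_mem]
      · simp
      · intro β _ h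
        simpa [SQAlgorithm.queries] using h.1
    by_cases hq : τ ≤ q.tol
    -- The parameters split in two: at most `M` forbid the reference answer. All the others send the
    -- algorithm into the same branch `next (ref q)`, with `m` queries left.
    · refine le_trans ?_ (le_trans (add_le_add (hM q hq) (ih (ref q) m)) ?_)
      · rw [← Nat.cast_add, Nat.cast_le]
        refine le_trans (Finset.card_le_card ?_) (Finset.card_union_le _ _)
        intro β hβ
        rw [Finset.mem_filter] at hβ
        rw [Finset.mem_union, Finset.mem_filter, Finset.mem_filter]
        obtain ⟨hB, h1, h2, h3⟩ := hβ
        by_cases hb : |ref q - ∫ z, q.f z ∂(D β)| ≤ q.tol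
        · have hO : lazyOracle ref (D β) q = ref q := if_pos hb
          simp only [SQAlgorithm.queries, SQAlgorithm.result, hO, List.length_cons,
            List.mem_cons, forall_eq_or_imp] at h1 h2 h3
          exact Or.inr ⟨hB, by omega, h2.2, h3⟩
        · exact Or.inl ⟨hB, not_le.1 hb⟩
      · push_cast
        linarith
    · rw [Finset.filter_false_of_mem]
      · simp only [Finset.card_empty, Nat.cast_zero]
        positivity
      · intro β _ h
        exact hq (h.2.1 q (by simp [SQAlgorithm.queries]))

open Classical in
/-- The lower bound for randomised algorithms: few queries of large tolerance are not enough to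
find one of many parameters. -/
theorem two_thirds_card_le {Ω : Type*} [MeasurableSpace Ω] (P : Measure Ω)
    [IsProbabilityMeasure P] (A : Ω → SQAlgorithm Z E) (B : Finset E) (D : E → Measure Z)
    (ref : SQQuery Z → ℝ) {δ τ M N : ℝ}
    (hsep : ∀ β ∈ B, ∀ β' ∈ B, β ≠ β' → 2 * δ < ‖β - β'‖)
    (hM : ∀ q : SQQuery Z, τ ≤ q.tol →
      ((B.filter fun β => q.tol < |ref q - ∫ z, q.f z ∂(D β)|).card : ℝ) ≤ M)
    (hM0 : 0 ≤ M) (hN : 0 ≤ N)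
    (hest : ∀ β ∈ B, Estimates P A (D β) β δ)
    (hfew : ∀ β ∈ B, ∀ O : SQQuery Z → ℝ, IsSTATOracle (D β) O →
      P {ω | N ≤ (((A ω).queries O).length : ℝ) ∨ ∃ q ∈ (A ω).queries O, q.tol < τ} = 0) :
    2 / 3 * (B.card : ℝ) ≤ 1 + N * M := by
  choose! S hSm hS hSout using fun β hβ =>
    hest β hβ (lazyOracle ref (D β)) (isSTATOracle_lazyOracle ref (D β))
  have hae : ∀ᵐ ω ∂P, ∀ β ∈ B,
      ¬ (N ≤ (((A ω).queries (lazyOracle ref (D β))).length : ℝ) ∨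
        ∃ q ∈ (A ω).queries (lazyOracle ref (D β)), q.tol < τ) := by
    rw [Finset.eventually_all]
    intro β hβ
    have := hfew β hβ _ (isSTATOracle_lazyOracle ref (D β))
    rw [ae_iff]
    simpa only [not_not] using this
  -- For almost every seed, the parameters on which it succeeds are counted by the deterministic
  -- bound. Fewer than `N` queries means at most `⌊N⌋₊`. Integrating over the seed and exchanging
  -- sum and integral then uses the success probability `2/3` of each parameter.
  have hcount : ∀ᵐ ω ∂P, ∑ β ∈ B, (S β).indicator (1 : Ω → ENNReal) ω ≤
      ENNReal.ofReal (1 + N * M) := by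
    filter_upwards [hae] with ω hω
    have h1 : ∑ β ∈ B, (S β).indicator (1 : Ω → ENNReal) ω =
        ((B.filter fun β => ω ∈ S β).card : ENNReal) := by
      rw [Finset.card_filter, Nat.cast_sum]
      refine Finset.sum_congr rfl fun β _ => ?_
      by_cases h : ω ∈ S β <;> simp [h]
    rw [h1, ← ENNReal.ofReal_natCast]
    refine ENNReal.ofReal_le_ofReal ?_
    have h2 := card_success_le B D ref hsep hM hM0 (A ω) ⌊N⌋₊
    have h3 : (⌊N⌋₊ : ℝ) * M ≤ N * M := mul_le_mul_of_nonneg_right (Nat.floor_le hN) hM0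
    refine le_trans (Nat.cast_le.2 (Finset.card_le_card ?_)) (h2.trans (by linarith))
    intro β hβ
    rw [Finset.mem_filter] at hβ ⊢
    have h4 := hω β hβ.1
    push Not at h4
    exact ⟨hβ.1, Nat.le_floor h4.1.le, h4.2, hSout β hβ.1 ω hβ.2⟩
  have h5 : ∑ β ∈ B, P (S β) ≤ ENNReal.ofReal (1 + N * M) := by
    calc ∑ β ∈ B, P (S β) = ∫⁻ ω, ∑ β ∈ B, (S β).indicator (1 : Ω → ENNReal) ω ∂P := by
          rw [lintegral_finsetSum' _ fun β hβ =>
            (measurable_one.indicator (hSm β hβ)).aemeasurable]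
          exact Finset.sum_congr rfl fun β hβ => (lintegral_indicator_one (hSm β hβ)).symm
      _ ≤ ∫⁻ _, ENNReal.ofReal (1 + N * M) ∂P := lintegral_mono_ae hcount
      _ = ENNReal.ofReal (1 + N * M) := by simp
  have h6 : ENNReal.ofReal (2 / 3 * B.card) ≤ ∑ β ∈ B, P (S β) := by
    have : ENNReal.ofReal (2 / 3 * B.card) = ∑ _β ∈ B, (2 / 3 : ENNReal) := by
      rw [Finset.sum_const, nsmul_eq_mul, ENNReal.ofReal_mul (by norm_num), mul_comm,
        ENNReal.ofReal_natCast, ENNReal.ofReal_div_of_pos (by norm_num)]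
      simp
    rw [this]
    exact Finset.sum_le_sum hS
  exact (ENNReal.ofReal_le_ofReal_iff (by positivity)).1 (h6.trans h5)

end Oracle

/-! ### Sparse, almost orthogonal unit vectors -/

/-- Reed–Solomon codes: two distinct codewords agree in at most `t` places. -/
lemma exists_code (p m t : ℕ) [Fact p.Prime] (hm : m ≤ p) :
    ∃ f : (Fin (t + 1) → ZMod p) → Fin m → ZMod p,
      ∀ a b, a ≠ b → (Finset.univ.filter fun i => f a i = f b i).card ≤ t := by
  classical
  refine ⟨fun a i => ∑ j, a j * ((i : ℕ) : ZMod p) ^ (j : ℕ), fun a b hab => ?_⟩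
  -- The codewords are the values at `0, …, m - 1` of polynomials of degree at most `t`. These
  -- points are distinct modulo `p` since `m ≤ p`, so agreements are distinct roots of the
  -- difference polynomial `P`.
  let P : Polynomial (ZMod p) := ∑ j, Polynomial.C (a j - b j) * Polynomial.X ^ (j : ℕ)
  have hP : P ≠ 0 := by
    intro h
    apply hab
    ext j
    have hc : P.coeff j = a j - b j := by
      simp only [P, Polynomial.finsetSum_coeff, Polynomial.coeff_C_mul, Polynomial.coeff_X_pow,
        Fin.val_inj, mul_ite, mul_one, mul_zero, Finset.sum_ite_eq, Finset.mem_univ, if_true]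
    rw [h, Polynomial.coeff_zero] at hc
    exact (sub_eq_zero.1 hc.symm)
  have hdeg : P.natDegree ≤ t :=
    Polynomial.natDegree_sum_le_of_forall_le _ _ fun j _ =>
      (Polynomial.natDegree_C_mul_X_pow_le _ _).trans (Nat.lt_succ_iff.1 j.2)
  have hinj : Set.InjOn (fun i : Fin m => ((i : ℕ) : ZMod p))
      (Finset.univ.filter fun i : Fin m => ∑ j, a j * ((i : ℕ) : ZMod p) ^ (j : ℕ) =
        ∑ j, b j * ((i : ℕ) : ZMod p) ^ (j : ℕ)) := by
    intro i _ i' _ h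
    have h' : ((i : ℕ) : ZMod p) = ((i' : ℕ) : ZMod p) := h
    rw [ZMod.natCast_eq_natCast_iff'] at h'
    rw [Nat.mod_eq_of_lt (i.2.trans_le hm), Nat.mod_eq_of_lt (i'.2.trans_le hm)] at h'
    exact Fin.ext h'
  rw [← Finset.card_image_of_injOn hinj]
  refine le_trans (Finset.card_le_card (t := P.roots.toFinset) ?_)
    ((Multiset.toFinset_card_le _).trans ((Polynomial.card_roots' P).trans hdeg))
  intro x hx
  obtain ⟨i, hi, rfl⟩ := Finset.mem_image.1 hx
  rw [Multiset.mem_toFinset, Polynomial.mem_roots hP, Polynomial.IsRoot.def]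
  have := (Finset.mem_filter.1 hi).2
  simp only [P, Polynomial.eval_finsetSum, Polynomial.eval_mul, Polynomial.eval_C,
    Polynomial.eval_pow, Polynomial.eval_X, sub_mul, Finset.sum_sub_distrib]
  rw [this, sub_self]

/-- The normalised indicator vector of the graph of `f`. -/
noncomputable def graphVector {d m : ℕ} {β : Type*} (e : Fin m × β ↪ Fin d) (f : Fin m → β) :
    EuclideanSpace ℝ (Fin d) :=
  (Real.sqrt m)⁻¹ • ∑ i, EuclideanSpace.single (e (i, f i)) (1 : ℝ)

open Classical in
lemma inner_graphVector {d m : ℕ} {β : Type*} (e : Fin m × β ↪ Fin d) (f g : Fin m → β) :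
    inner ℝ (graphVector e f) (graphVector e g) =
      ((Finset.univ.filter fun i => f i = g i).card : ℝ) / m := by
  rw [graphVector, graphVector, real_inner_smul_left, real_inner_smul_right, sum_inner]
  simp_rw [inner_sum, EuclideanSpace.inner_single_left, PiLp.single_apply]
  have h : ∀ i j : Fin m, (e (i, f i) = e (j, g j)) ↔ (i = j ∧ f i = g j) := by
    intro i j
    rw [e.injective.eq_iff, Prod.mk.injEq]
  have h2 : ∀ i : Fin m, ∑ j : Fin m, (starRingEnd ℝ) (1 : ℝ) *
      (if e (i, f i) = e (j, g j) then (1 : ℝ) else 0) = if f i = g i then 1 else 0 := by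
    intro i
    rw [Finset.sum_eq_single i]
    · simp [h]
    · intro j _ hj
      simp [h, hj.symm]
    · simp
  simp_rw [h2]
  rw [Finset.sum_boole, ← mul_assoc, ← mul_inv, Real.mul_self_sqrt (Nat.cast_nonneg m)]
  ring

lemma isSparse_smul_graphVector {d m k : ℕ} {β : Type*} (e : Fin m × β ↪ Fin d) (f : Fin m → β)
    (h : m ≤ k) (a : ℝ) : IsSparse k (a • graphVector e f) := by
  classical
  unfold IsSparse
  have hsub : {i : Fin d | (a • graphVector e f) i ≠ 0} ⊆
      ((Finset.univ.image fun i => e (i, f i) : Finset (Fin d)) : Set (Fin d)) := by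
    intro x hx
    by_contra hne
    apply hx
    simp only [Finset.coe_image, Finset.coe_univ, Set.image_univ, Set.mem_range, not_exists] at hne
    simp only [graphVector, PiLp.smul_apply, WithLp.ofLp_sum, Finset.sum_apply,
      PiLp.single_apply, smul_eq_mul]
    rw [Finset.sum_eq_zero]
    · simp
    · intro i _
      exact if_neg fun h => hne i h.symm
  refine (Set.ncard_le_ncard hsub (Finset.finite_toSet _)).trans ?_
  rw [Set.ncard_coe_finset]
  exact Finset.card_image_le.trans (by simpa using h)

/-- A large family of sparse unit vectors with small pairwise inner products. -/
theorem exists_sparse_family {k d : ℕ} {c : ℝ} (hk : 2 ≤ k) (hkd : (k : ℝ) ≤ Real.sqrt d)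
    (hc0 : 0 < c) (hc1 : c < 1) :
    ∃ V : Finset (EuclideanSpace ℝ (Fin d)),
      (∀ v ∈ V, (∀ a : ℝ, IsSparse k (a • v)) ∧ ‖v‖ = 1) ∧
      (∀ v ∈ V, ∀ v' ∈ V, v ≠ v' → |inner ℝ v v'| ≤ (k : ℝ) ^ (-1 + c)) ∧
      2 ≤ V.card ∧ (d : ℝ) ^ (c * (k : ℝ) ^ c / 8) ≤ V.card := by
  classical
  have hk0 : (0 : ℝ) < k := by positivity
  have hkd' : k * k ≤ d := by
    have h := (Real.le_sqrt hk0.le (Nat.cast_nonneg d)).1 hkd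
    rw [sq] at h
    exact_mod_cast h
  -- Using only `k / 2` nonzero coordinates leaves room for the factor two lost in Bertrand's
  -- postulate: `n < p ≤ 2n` with `n = d / (2m)` gives both `m p ≤ d` and, further down, `d ≤ p²`.
  obtain ⟨m, hm⟩ : ∃ m, m = k / 2 := ⟨_, rfl⟩
  have hm1 : 1 ≤ m := by omega
  have hmk : 2 * m ≤ k := by omega
  obtain ⟨n, hn⟩ : ∃ n, n = d / (2 * m) := ⟨_, rfl⟩
  have hkn : k ≤ n := by
    rw [hn, Nat.le_div_iff_mul_le (by omega)]
    exact (Nat.mul_le_mul_left k hmk).trans hkd'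
  obtain ⟨p, hp, hnp, hpn⟩ := Nat.exists_prime_lt_and_le_two_mul n (by omega)
  have : Fact p.Prime := ⟨hp⟩
  have hmp : m * p ≤ d := by
    calc m * p ≤ m * (2 * n) := Nat.mul_le_mul_left m hpn
      _ = n * (2 * m) := by ring
      _ ≤ d := by rw [hn]; exact Nat.div_mul_le_self _ _
  have hkc1 : (k : ℝ) ^ (-1 + c) < 1 :=
    Real.rpow_lt_one_of_one_lt_of_neg (by exact_mod_cast hk) (by linarith)
  have hkc0 : (0 : ℝ) < (k : ℝ) ^ (-1 + c) := Real.rpow_pos_of_pos hk0 _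
  have hmpos : (0 : ℝ) < m := by exact_mod_cast hm1
  -- Codewords agreeing in at most `t` of `m` places give inner product at most `t / m ≤ k ^ (-1 +
  -- c)`. There are `p ^ (t + 1)` codewords.
  obtain ⟨t, ht⟩ : ∃ t, t = ⌊(m : ℝ) * (k : ℝ) ^ (-1 + c)⌋₊ := ⟨_, rfl⟩
  have htm : t < m := by
    rw [ht, Nat.floor_lt (by positivity)]
    nlinarith
  obtain ⟨f, hf⟩ := exists_code p m t (by omega)
  have hcard : Fintype.card (Fin m × ZMod p) ≤ Fintype.card (Fin d) := by
    simpa [ZMod.card] using hmp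
  obtain ⟨e⟩ := Function.Embedding.nonempty_of_card_le hcard
  have hunit : ∀ a, inner ℝ (graphVector e (f a)) (graphVector e (f a)) = (1 : ℝ) := by
    intro a
    rw [inner_graphVector]
    simp [hmpos.ne']
  have hinner : ∀ a b, a ≠ b →
      inner ℝ (graphVector e (f a)) (graphVector e (f b)) ≤ (t : ℝ) / m := by
    intro a b hab
    rw [inner_graphVector]
    have h := hf a b hab
    gcongr
    exact le_trans (le_of_eq (by congr!)) h
  have htm1 : (t : ℝ) / m < 1 := by
    rw [div_lt_one hmpos]; exact_mod_cast htm
  have hinj : Function.Injective fun a => graphVector e (f a) := by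
    intro a b hab
    by_contra hne
    have h1 := hinner a b hne
    have h2 : graphVector e (f a) = graphVector e (f b) := hab
    rw [← h2, hunit] at h1
    linarith
  have hVcard : (Finset.univ.image fun a => graphVector e (f a)).card = p ^ (t + 1) := by
    rw [Finset.card_image_of_injective _ hinj, Finset.card_univ]
    simp [ZMod.card]
  refine ⟨Finset.univ.image fun a => graphVector e (f a), ?_, ?_, ?_, ?_⟩
  · intro v hv
    obtain ⟨a, -, rfl⟩ := Finset.mem_image.1 hv
    refine ⟨fun r => isSparse_smul_graphVector e (f a) (by omega) r, ?_⟩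
    have := hunit a
    rw [real_inner_self_eq_norm_sq] at this
    nlinarith [norm_nonneg (graphVector e (f a))]
  · intro v hv v' hv' hne
    obtain ⟨a, -, rfl⟩ := Finset.mem_image.1 hv
    obtain ⟨b, -, rfl⟩ := Finset.mem_image.1 hv'
    have hab : a ≠ b := fun h => hne (by rw [h])
    have h0 : 0 ≤ inner ℝ (graphVector e (f a)) (graphVector e (f b)) := by
      rw [inner_graphVector]; positivity
    rw [abs_of_nonneg h0]
    refine (hinner a b hab).trans ?_
    rw [div_le_iff₀ hmpos, ht, mul_comm]
    exact Nat.floor_le (by positivity)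
  · rw [hVcard]
    exact hp.two_le.trans (Nat.le_self_pow (by omega) p)
  · rw [hVcard]
    have hd0 : (0 : ℝ) ≤ d := Nat.cast_nonneg d
    have hd1 : (1 : ℝ) ≤ d := by
      have : 1 ≤ d := by nlinarith
      exact_mod_cast this
    have hdp : (d : ℝ) ≤ (p : ℝ) ^ (2 : ℝ) := by
      have h1 : d < (n + 1) * (2 * m) := by
        rw [hn, mul_comm]; exact Nat.lt_mul_div_succ d (by omega)
      have h2 : d ≤ p ^ 2 := by
        have : (n + 1) * (2 * m) ≤ p * p := Nat.mul_le_mul (by omega) (by omega)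
        rw [sq]; omega
      rw [Real.rpow_two]
      exact_mod_cast h2
    -- The factor `2` comes from `d ≤ p²`. The rest follows from `k ≤ 4m` and `m k ^ (-1 + c) < t +
    -- 1`.
    have hexp : c * (k : ℝ) ^ c / 8 * 2 ≤ (t + 1 : ℕ) := by
      have h1 : (m : ℝ) * (k : ℝ) ^ (-1 + c) < t + 1 := by
        rw [ht]; exact Nat.lt_floor_add_one _
      have h2 : (k : ℝ) ^ c = k * (k : ℝ) ^ (-1 + c) := by
        rw [← Real.rpow_one_add' hk0.le (by linarith)]
        congr 1; ring
      have h3 : (k : ℝ) ≤ 4 * m := by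
        have : k ≤ 4 * m := by omega
        exact_mod_cast this
      push_cast
      rw [h2]
      have h4 : c * (k * (k : ℝ) ^ (-1 + c)) ≤ 1 * (4 * m * (k : ℝ) ^ (-1 + c)) := by
        gcongr
      nlinarith
    have hp1 : (1 : ℝ) ≤ p := by exact_mod_cast hp.one_lt.le
    calc (d : ℝ) ^ (c * (k : ℝ) ^ c / 8) ≤ ((p : ℝ) ^ (2 : ℝ)) ^ (c * (k : ℝ) ^ c / 8) :=
          Real.rpow_le_rpow hd0 hdp (by positivity)
      _ = (p : ℝ) ^ (c * (k : ℝ) ^ c / 8 * 2) := by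
          rw [← Real.rpow_mul (by positivity), mul_comm]
      _ ≤ (p : ℝ) ^ (((t + 1 : ℕ) : ℝ)) := Real.rpow_le_rpow_of_exponent_le hp1 hexp
      _ = ((p ^ (t + 1) : ℕ) : ℝ) := by rw [Real.rpow_natCast]; push_cast; rfl

/-! ### The perturbation of the reference density -/

/-- The density of the law of `y` under the noise with respect to `N(0, 1)`. -/
noncomputable def noiseWeight (y : ℝ) : ℝ := (1 + y ^ 2) / 2

/-- The opposite of the mean of the noise in the hidden direction, given `y`. -/
noncomputable def noiseShift (α ε y : ℝ) : ℝ := (1 - ε) * α * y / (ε * noiseWeight y)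

/-- The difference between the density of the corrupted distribution and the reference density,
in terms of `y` and of the component `u` of `x` in the hidden direction. -/
noncomputable def excess (α σ ε : ℝ) (u y : ℝ) : ℝ :=
  (1 - ε) * gaussianRatio (α * y) σ u
    + ε * (noiseWeight y * gaussianRatio (-noiseShift α ε y) 1 u)
    - ((1 - ε) + ε * noiseWeight y)

lemma noiseWeight_pos (y : ℝ) : 0 < noiseWeight y := by unfold noiseWeight; positivity

@[fun_prop]
lemma measurable_noiseWeight : Measurable noiseWeight := by unfold noiseWeight; fun_prop

@[fun_prop]
lemma measurable_noiseShift {α ε : ℝ} : Measurable (noiseShift α ε) := by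
  unfold noiseShift; fun_prop

@[fun_prop]
lemma measurable_excess {Z : Type*} [MeasurableSpace Z] {α σ ε : ℝ} {u y : Z → ℝ}
    (hu : Measurable u) (hy : Measurable y) :
    Measurable fun z => excess α σ ε (u z) (y z) := by
  have h1 : Measurable fun z => noiseWeight (y z) := measurable_noiseWeight.comp hy
  have h2 : Measurable fun z => noiseShift α ε (y z) := measurable_noiseShift.comp hy
  unfold excess
  fun_prop

lemma integrable_excess {α σ ε : ℝ} (hσ : 0 < σ) (y : ℝ) :
    Integrable (fun u => (1 - ε) * gaussianRatio (α * y) σ u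
    + ε * (noiseWeight y * gaussianRatio (-noiseShift α ε y) 1 u)) (gaussianReal 0 1) :=
  ((integrable_gaussianRatio hσ).const_mul _).add
    (((integrable_gaussianRatio one_pos).const_mul _).const_mul _)

lemma integral_excess {α σ ε : ℝ} (hσ : 0 < σ) (y : ℝ) :
    ∫ u, excess α σ ε u y ∂(gaussianReal 0 1) = 0 := by
  unfold excess
  rw [integral_sub (integrable_excess hσ y) (integrable_const _),
    integral_add ((integrable_gaussianRatio hσ).const_mul _)
    (((integrable_gaussianRatio one_pos).const_mul _).const_mul _)]
  simp only [integral_const_mul, integral_gaussianRatio hσ, integral_gaussianRatio one_pos]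
  simp

/-- This is what the outliers are designed for: the inliers contribute `(1 - ε) α y` to the first
moment, and `noiseShift` is chosen so that the outliers contribute its opposite. -/
lemma integral_mul_excess {α σ ε : ℝ} (hσ : 0 < σ) (hε : 0 < ε) (y : ℝ) :
    ∫ u, u * excess α σ ε u y ∂(gaussianReal 0 1) = 0 := by
  have h1 := (integrable_mul_gaussianRatio (m := α * y) hσ).const_mul (1 - ε)
  have h2 := ((integrable_mul_gaussianRatio (m := -noiseShift α ε y) one_pos).const_mul
    (noiseWeight y)).const_mul ε
  have h3 : Integrable (fun u : ℝ => u) (gaussianReal 0 1) :=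
    (memLp_id_gaussianReal 1).integrable (by simp)
  have h4 := h3.const_mul ((1 - ε) + ε * noiseWeight y)
  have h : ∀ u, u * excess α σ ε u y = (1 - ε) * (u * gaussianRatio (α * y) σ u)
      + ε * (noiseWeight y * (u * gaussianRatio (-noiseShift α ε y) 1 u))
      - ((1 - ε) + ε * noiseWeight y) * u := fun u => by unfold excess; ring
  simp_rw [h]
  have h5 : Integrable (fun u => (1 - ε) * (u * gaussianRatio (α * y) σ u)
      + ε * (noiseWeight y * (u * gaussianRatio (-noiseShift α ε y) 1 u))) (gaussianReal 0 1) :=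
    h1.add h2
  have h6 : ∫ u, ((1 - ε) + ε * noiseWeight y) * u ∂(gaussianReal 0 1) = 0 := by
    rw [integral_const_mul, integral_id_gaussianReal, mul_zero]
  rw [integral_sub h5 h4, integral_add h1 h2, h6]
  simp only [integral_const_mul, integral_mul_gaussianRatio hσ,
    integral_mul_gaussianRatio one_pos]
  have := noiseWeight_pos y
  unfold noiseShift
  field_simp
  ring

/-- `exp (u² / 4)` is `√2` times the density of `N(0, 2)` with respect to `N(0, 1)`. -/
lemma integral_exp_sq_div_four :
    Integrable (fun u : ℝ => Real.exp (u ^ 2 / 4)) (gaussianReal 0 1) ∧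
    ∫ u, Real.exp (u ^ 2 / 4) ∂(gaussianReal 0 1) = Real.sqrt 2 := by
  have h2 : (0 : ℝ) < Real.sqrt 2 := by positivity
  have h : ∀ u : ℝ, Real.exp (u ^ 2 / 4) = Real.sqrt 2 * gaussianRatio 0 (Real.sqrt 2) u := by
    intro u
    rw [gaussianRatio, ← mul_assoc, mul_inv_cancel₀ h2.ne', one_mul,
      Real.sq_sqrt (by norm_num)]
    congr 1
    ring
  simp_rw [h]
  refine ⟨(integrable_gaussianRatio h2).const_mul _, ?_⟩
  rw [integral_const_mul, integral_gaussianRatio h2, mul_one]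

/-- The weight `(1 + y²) / 2` dominates `|y|`, so the shift stays bounded as `y` grows. The factor
`3` is the one needed to bound the squared outlier density in `sq_excess_le`. -/
lemma sq_noiseShift_le {α ε : ℝ} (hα0 : 0 ≤ α) (hα : α ≤ 1 / 10) (hε : 0 < ε) (hε1 : ε < 1)
    (y : ℝ) : 3 * noiseShift α ε y ^ 2 ≤ 1 / ε ^ 2 := by
  have hw := noiseWeight_pos y
  have hy : |y| ≤ noiseWeight y := by
    rw [abs_le]
    unfold noiseWeight
    constructor <;> nlinarith [sq_nonneg (y - 1), sq_nonneg (y + 1)]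
  have h1 : |noiseShift α ε y| ≤ (1 / 10) / ε := by
    rw [noiseShift, abs_div, abs_mul, abs_mul, abs_of_nonneg hα0,
      abs_of_nonneg (by linarith : 0 ≤ 1 - ε), abs_of_pos (mul_pos hε hw),
      div_le_div_iff₀ (mul_pos hε hw) hε]
    have h2 : (1 - ε) * α * |y| ≤ 1 * (1 / 10) * noiseWeight y := by
      gcongr; linarith
    nlinarith
  rw [← sq_abs]
  calc 3 * |noiseShift α ε y| ^ 2 ≤ 3 * ((1 / 10) / ε) ^ 2 := by gcongr
    _ ≤ 1 / ε ^ 2 := by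
      rw [div_pow, mul_div_assoc']
      gcongr
      norm_num

lemma sq_excess_le {α σ ε : ℝ} (hσ : 0 < σ) (hασ : α ^ 2 + σ ^ 2 = 1) (hα0 : 0 ≤ α)
    (hα : α ≤ 1 / 10) (hε : 0 < ε) (hε1 : ε < 1) (u y : ℝ) :
    excess α σ ε u y ^ 2 ≤
      140 * Real.exp (1 / ε ^ 2) * (Real.exp (u ^ 2 / 4) * Real.exp (y ^ 2 / 4)) := by
  have hσ2 : 99 / 100 ≤ σ ^ 2 := by nlinarith
  have hE1 : 1 ≤ Real.exp (1 / ε ^ 2) := Real.one_le_exp (by positivity)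
  have hU1 : 1 ≤ Real.exp (u ^ 2 / 4) := Real.one_le_exp (by positivity)
  have hY1 : 1 ≤ Real.exp (y ^ 2 / 4) := Real.one_le_exp (by positivity)
  have hA : gaussianRatio (α * y) σ u ^ 2 ≤ 2 * (Real.exp (u ^ 2 / 4) * Real.exp (y ^ 2 / 4)) := by
    rw [gaussianRatio, mul_pow, ← Real.exp_nat_mul, ← Real.exp_add]
    gcongr
    · rw [inv_pow]
      exact inv_le_of_inv_le₀ (by norm_num) (by linarith)
    · have h2 : 2 * α * (u * y) ≤ α * (u ^ 2 + y ^ 2) := by nlinarith [sq_nonneg (u - y)]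
      have h3 : α * (u ^ 2 + y ^ 2) ≤ 1 / 10 * (u ^ 2 + y ^ 2) := by gcongr
      have e : ((2 : ℕ) : ℝ) * (u ^ 2 / 2 - (u - α * y) ^ 2 / (2 * σ ^ 2)) =
          u ^ 2 - (u - α * y) ^ 2 / σ ^ 2 := by push_cast; field_simp
      rw [e, sub_le_iff_le_add, ← sub_le_iff_le_add', le_div_iff₀ (by positivity)]
      have h4 : σ ^ 2 = 1 - α ^ 2 := by linarith
      have h5 : σ ^ 2 * (u ^ 2 / 4 + y ^ 2 / 4) ≥ 99 / 100 * (u ^ 2 / 4 + y ^ 2 / 4) := by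
        gcongr
      nlinarith [sq_nonneg (α * u), sq_nonneg (α * y)]
  have hw : noiseWeight y ^ 2 ≤ 16 * Real.exp (y ^ 2 / 4) := by
    have h1 : noiseWeight y ≤ 4 * Real.exp (y ^ 2 / 8) := by
      have := Real.add_one_le_exp (y ^ 2 / 8)
      unfold noiseWeight
      linarith
    calc noiseWeight y ^ 2 ≤ (4 * Real.exp (y ^ 2 / 8)) ^ 2 := by
          have := (noiseWeight_pos y).le
          gcongr
      _ = 16 * Real.exp (y ^ 2 / 4) := by
          rw [mul_pow, ← Real.exp_nat_mul]; push_cast; ring_nf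
  -- With `s` the shift, the exponent is `-2su - s²`, and `-2su ≤ 4s² + u² / 4` leaves `3s² + u² /
  -- 4`.
  have hB : gaussianRatio (-noiseShift α ε y) 1 u ^ 2 ≤
      Real.exp (1 / ε ^ 2) * Real.exp (u ^ 2 / 4) := by
    rw [gaussianRatio_one, ← Real.exp_nat_mul, ← Real.exp_add]
    gcongr
    have := sq_noiseShift_le hα0 hα hε hε1 y
    push_cast
    nlinarith [sq_nonneg (2 * noiseShift α ε y + u / 2)]
  set a := gaussianRatio (α * y) σ u
  set b := gaussianRatio (-noiseShift α ε y) 1 u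
  set w := noiseWeight y
  set X := Real.exp (1 / ε ^ 2)
  set U := Real.exp (u ^ 2 / 4)
  set Y := Real.exp (y ^ 2 / 4)
  have hUY : 1 ≤ U * Y := one_le_mul_of_one_le_of_one_le hU1 hY1
  have hwb : (w * b) ^ 2 ≤ 16 * X * (U * Y) := by
    rw [mul_pow]
    calc w ^ 2 * b ^ 2 ≤ (16 * Y) * (X * U) := by gcongr
      _ = _ := by ring
  have hXUY : U * Y ≤ X * (U * Y) := le_mul_of_one_le_left (by positivity) hE1
  have hYUY : Y ≤ U * Y := le_mul_of_one_le_left (by positivity) hU1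
  have e1 : ((1 - ε) * a) ^ 2 ≤ a ^ 2 := by
    rw [mul_pow]
    exact mul_le_of_le_one_left (sq_nonneg a) (pow_le_one₀ (by linarith) (by linarith))
  have e2 : (ε * (w * b)) ^ 2 ≤ (w * b) ^ 2 := by
    rw [mul_pow ε]
    exact mul_le_of_le_one_left (sq_nonneg _) (pow_le_one₀ (by linarith) (by linarith))
  have e3 : (ε * w) ^ 2 ≤ w ^ 2 := by
    rw [mul_pow ε]
    exact mul_le_of_le_one_left (sq_nonneg _) (pow_le_one₀ (by linarith) (by linarith))
  have e4 : (1 - ε) ^ 2 ≤ 1 := pow_le_one₀ (by linarith) (by linarith)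
  -- The four squares are at most `2`, `16`, `1` and `16` times `X * (U * Y)`, whence `4 * 35 =
  -- 140`.
  have key : ∀ p q r s : ℝ, (p + q - (r + s)) ^ 2 ≤ 4 * (p ^ 2 + q ^ 2 + r ^ 2 + s ^ 2) := by
    intro p q r s
    nlinarith [sq_nonneg (p - q), sq_nonneg (p + r), sq_nonneg (p + s), sq_nonneg (q + r),
      sq_nonneg (q + s), sq_nonneg (r - s)]
  have := key ((1 - ε) * a) (ε * (w * b)) (1 - ε) (ε * w)
  unfold excess
  linarith

lemma memLp_excess {α σ ε : ℝ} (hσ : 0 < σ) (hασ : α ^ 2 + σ ^ 2 = 1) (hα0 : 0 ≤ α)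
    (hα : α ≤ 1 / 10) (hε : 0 < ε) (hε1 : ε < 1) (y : ℝ) :
    MemLp (fun u => excess α σ ε u y) 2 (gaussianReal 0 1) := by
  rw [memLp_two_iff_integrable_sq (by fun_prop)]
  refine ((integral_exp_sq_div_four.1.mul_const (Real.exp (y ^ 2 / 4))).const_mul
    (140 * Real.exp (1 / ε ^ 2))).mono' (by fun_prop) (.of_forall fun u => ?_)
  rw [Real.norm_of_nonneg (sq_nonneg _)]
  exact sq_excess_le hσ hασ hα0 hα hε hε1 u y

lemma integrable_sq_excess {α σ ε : ℝ} (hσ : 0 < σ) (hασ : α ^ 2 + σ ^ 2 = 1) (hα0 : 0 ≤ α)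
    (hα : α ≤ 1 / 10) (hε : 0 < ε) (hε1 : ε < 1) :
    Integrable (fun p : ℝ × ℝ => excess α σ ε p.1 p.2 ^ 2)
      ((gaussianReal 0 1).prod (gaussianReal 0 1)) ∧
    ∫ p : ℝ × ℝ, excess α σ ε p.1 p.2 ^ 2 ∂((gaussianReal 0 1).prod (gaussianReal 0 1)) ≤
      280 * Real.exp (1 / ε ^ 2) := by
  have h1 := (integral_exp_sq_div_four.1.mul_prod integral_exp_sq_div_four.1).const_mul
    (140 * Real.exp (1 / ε ^ 2))
  have h2 : Integrable (fun p : ℝ × ℝ => excess α σ ε p.1 p.2 ^ 2)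
      ((gaussianReal 0 1).prod (gaussianReal 0 1)) := by
    refine h1.mono' (by fun_prop) (.of_forall fun p => ?_)
    rw [Real.norm_of_nonneg (sq_nonneg _)]
    exact sq_excess_le hσ hασ hα0 hα hε hε1 p.1 p.2
  refine ⟨h2, (integral_mono h2 h1 fun p => sq_excess_le hσ hασ hα0 hα hε hε1 p.1 p.2).trans ?_⟩
  rw [integral_const_mul, integral_prod_mul (fun u : ℝ => Real.exp (u ^ 2 / 4))
    (fun u : ℝ => Real.exp (u ^ 2 / 4)), integral_exp_sq_div_four.2,
    Real.mul_self_sqrt (by norm_num)]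
  linarith

/-! ### Correlations of the perturbations in different directions -/

section Direction

variable {E : Type*} [NormedAddCommGroup E] [InnerProductSpace ℝ E] [FiniteDimensional ℝ E]
  [MeasurableSpace E] [BorelSpace E]

lemma measurePreserving_inner_prod {v : E} (hv : ‖v‖ = 1) :
    MeasurePreserving (fun p : E × ℝ => (inner ℝ v p.1, p.2))
      ((stdGaussian E).prod (gaussianReal 0 1)) ((gaussianReal 0 1).prod (gaussianReal 0 1)) :=
  (measurePreserving_inner hv).prod (MeasurePreserving.id _)

lemma memLp_excess_inner {α σ ε : ℝ} (hσ : 0 < σ) (hασ : α ^ 2 + σ ^ 2 = 1) (hα0 : 0 ≤ α)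
    (hα : α ≤ 1 / 10) (hε : 0 < ε) (hε1 : ε < 1) {v : E} (hv : ‖v‖ = 1) :
    MemLp (fun p : E × ℝ => excess α σ ε (inner ℝ v p.1) p.2) 2
      ((stdGaussian E).prod (gaussianReal 0 1)) := by
  rw [memLp_two_iff_integrable_sq (Measurable.aestronglyMeasurable (by fun_prop))]
  exact (measurePreserving_inner_prod hv).integrable_comp_of_integrable
    (integrable_sq_excess hσ hασ hα0 hα hε hε1).1

lemma integral_sq_excess_inner_le {α σ ε : ℝ} (hσ : 0 < σ) (hασ : α ^ 2 + σ ^ 2 = 1)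
    (hα0 : 0 ≤ α) (hα : α ≤ 1 / 10) (hε : 0 < ε) (hε1 : ε < 1) {v : E} (hv : ‖v‖ = 1) :
    ∫ p : E × ℝ, excess α σ ε (inner ℝ v p.1) p.2 ^ 2 ∂((stdGaussian E).prod (gaussianReal 0 1)) ≤
      280 * Real.exp (1 / ε ^ 2) := by
  have h := integrable_sq_excess hσ hασ hα0 hα hε hε1
  refine le_trans (le_of_eq ?_) h.2
  have hm := measurePreserving_inner_prod (E := E) hv
  rw [← hm.map_eq, integral_map hm.aemeasurable (by fun_prop)]

/-- For each fixed `y`, the perturbation is orthogonal to affine functions of `u`, so the projection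
bound applies on the fibre. Integrating over `y` turns the fibrewise second moments into the total
one. -/
lemma abs_integral_excess_mul_excess_le {α σ ε : ℝ} (hσ : 0 < σ) (hασ : α ^ 2 + σ ^ 2 = 1)
    (hα0 : 0 ≤ α) (hα : α ≤ 1 / 10) (hε : 0 < ε) (hε1 : ε < 1) {v v' : E} (hv : ‖v‖ = 1)
    (hv' : ‖v'‖ = 1) :
    |∫ p : E × ℝ, excess α σ ε (inner ℝ v p.1) p.2 * excess α σ ε (inner ℝ v' p.1) p.2
      ∂((stdGaussian E).prod (gaussianReal 0 1))| ≤
      inner ℝ v v' ^ 2 * (280 * Real.exp (1 / ε ^ 2)) := by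
  have hint : Integrable (fun p : E × ℝ =>
      excess α σ ε (inner ℝ v p.1) p.2 * excess α σ ε (inner ℝ v' p.1) p.2)
      ((stdGaussian E).prod (gaussianReal 0 1)) :=
    (memLp_excess_inner hσ hασ hα0 hα hε hε1 hv).integrable_mul
      (memLp_excess_inner hσ hασ hα0 hα hε hε1 hv')
  have hsq := integrable_sq_excess hσ hασ hα0 hα hε hε1
  rw [integral_prod_symm _ hint]
  calc |∫ y, ∫ x, excess α σ ε (inner ℝ v x) y * excess α σ ε (inner ℝ v' x) y ∂(stdGaussian E)
        ∂(gaussianReal 0 1)|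
      ≤ ∫ y, |∫ x, excess α σ ε (inner ℝ v x) y * excess α σ ε (inner ℝ v' x) y ∂(stdGaussian E)|
        ∂(gaussianReal 0 1) := abs_integral_le_integral_abs
    _ ≤ ∫ y, inner ℝ v v' ^ 2 * ∫ u, excess α σ ε u y ^ 2 ∂(gaussianReal 0 1)
        ∂(gaussianReal 0 1) := by
        refine integral_mono hint.integral_prod_right.abs
          (hsq.1.integral_prod_right.const_mul _) fun y => ?_
        exact abs_integral_inner_mul_inner_le hv hv' (memLp_excess hσ hασ hα0 hα hε hε1 y)
          (integral_excess hσ y) (integral_mul_excess hσ hε y)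
    _ = inner ℝ v v' ^ 2 * ∫ p : ℝ × ℝ, excess α σ ε p.1 p.2 ^ 2
        ∂((gaussianReal 0 1).prod (gaussianReal 0 1)) := by
        rw [integral_const_mul, integral_prod_symm _ hsq.1]
    _ ≤ _ := by
        gcongr
        exact hsq.2

end Direction

/-- A bounded query correlates with few of a family of almost orthogonal functions. -/
lemma card_mul_sub_le {Z ι : Type*} [MeasurableSpace Z] {μ : Measure Z} [IsProbabilityMeasure μ]
    {F : ι → Z → ℝ} {f : Z → ℝ} (hf : Measurable f) (hf1 : ∀ z, |f z| ≤ 1) (T : Finset ι)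
    (hF : ∀ i ∈ T, MemLp (F i) 2 μ) {χ κ τ : ℝ} (hτ : 0 ≤ τ)
    (hT : ∀ i ∈ T, τ ≤ |∫ z, f z * F i z ∂μ|)
    (hχ : ∀ i ∈ T, ∫ z, F i z ^ 2 ∂μ ≤ χ) (hκ0 : 0 ≤ κ)
    (hκ : ∀ i ∈ T, ∀ j ∈ T, i ≠ j → |∫ z, F i z * F j z ∂μ| ≤ κ) :
    (T.card : ℝ) * (τ ^ 2 - κ) ≤ χ ∨ T = ∅ := by
  classical
  rcases T.eq_empty_or_nonempty with h | hne
  · exact Or.inr h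
  left
  -- The signs make all correlations add up in `G = ∑ s i * F i`. The bound then comes from `(|T|
  -- τ)² ≤ (∫ f G)² ≤ ∫ G² ≤ |T| (χ + |T| κ)`.
  let s : ι → ℝ := fun i => SignType.sign (∫ z, f z * F i z ∂μ)
  have hs : ∀ i j, |s i * s j| ≤ 1 := by
    intro i j
    have : ∀ i, |s i| ≤ 1 := fun i => by
      rcases lt_trichotomy (∫ z, f z * F i z ∂μ) 0 with h | h | h <;> simp [s, h]
    rw [abs_mul]
    exact mul_le_one₀ (this i) (abs_nonneg _) (this j)
  let G : Z → ℝ := fun z => ∑ i ∈ T, s i * F i z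
  have hG : MemLp G 2 μ := memLp_finsetSum T fun i hi => (hF i hi).const_mul (s i)
  have hfG : MemLp (fun z => f z * G z) 2 μ := by
    refine hG.mono (hf.aestronglyMeasurable.mul hG.1) (.of_forall fun z => ?_)
    rw [norm_mul]
    exact mul_le_of_le_one_left (norm_nonneg _) (hf1 z)
  have hfF : ∀ i ∈ T, Integrable (fun z => f z * F i z) μ := fun i hi =>
    ((hF i hi).integrable (by norm_num)).bdd_mul hf.aestronglyMeasurable (.of_forall hf1)
  have h1 : (T.card : ℝ) * τ ≤ ∫ z, f z * G z ∂μ := by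
    have h2 : ∫ z, f z * G z ∂μ = ∑ i ∈ T, s i * ∫ z, f z * F i z ∂μ := by
      simp_rw [G, Finset.mul_sum, ← integral_const_mul]
      rw [← integral_finsetSum _ fun i hi => (hfF i hi).const_mul (s i)]
      refine integral_congr_ae (.of_forall fun z => Finset.sum_congr rfl fun i _ => ?_)
      ring
    rw [h2, ← nsmul_eq_mul]
    refine Finset.card_nsmul_le_sum _ _ _ fun i hi => ?_
    rw [sign_mul_self]
    exact hT i hi
  have h3 : (∫ z, f z * G z ∂μ) ^ 2 ≤ ∫ z, G z ^ 2 ∂μ := by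
    -- Nonnegative variance is Cauchy–Schwarz against the constant `1` for the probability measure
    -- `μ`.
    have hv := variance_nonneg (fun z => f z * G z) μ
    rw [variance_eq_sub hfG] at hv
    refine (sub_nonneg.1 hv).trans (integral_mono hfG.integrable_sq hG.integrable_sq fun z => ?_)
    simp only [Pi.pow_apply, mul_pow]
    refine mul_le_of_le_one_left (sq_nonneg _) ?_
    rw [← sq_abs]
    exact pow_le_one₀ (abs_nonneg _) (hf1 z)
  have hFF : ∀ i ∈ T, ∀ j ∈ T, Integrable (fun z => F i z * F j z) μ := fun i hi j hj =>
    (hF i hi).integrable_mul (hF j hj)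
  have h4 : ∫ z, G z ^ 2 ∂μ = ∑ i ∈ T, ∑ j ∈ T, s i * s j * ∫ z, F i z * F j z ∂μ := by
    have h5 : ∀ z, G z ^ 2 = ∑ i ∈ T, ∑ j ∈ T, s i * s j * (F i z * F j z) := by
      intro z
      simp only [G]
      rw [sq, Finset.sum_mul_sum]
      exact Finset.sum_congr rfl fun i _ => Finset.sum_congr rfl fun j _ => by ring
    simp_rw [h5]
    rw [integral_finsetSum _ fun i hi => integrable_finsetSum _ fun j hj =>
      (hFF i hi j hj).const_mul _]
    refine Finset.sum_congr rfl fun i hi => ?_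
    rw [integral_finsetSum _ fun j hj => (hFF i hi j hj).const_mul _]
    exact Finset.sum_congr rfl fun j _ => integral_const_mul _ _
  have h6 : ∫ z, G z ^ 2 ∂μ ≤ T.card * (χ + T.card * κ) := by
    rw [h4, ← nsmul_eq_mul]
    refine Finset.sum_le_card_nsmul _ _ _ fun i hi => ?_
    rw [← Finset.add_sum_erase _ _ hi]
    have hc : ∀ j, s i * s j * ∫ z, F i z * F j z ∂μ ≤ |∫ z, F i z * F j z ∂μ| := fun j => by
      refine (le_abs_self _).trans ?_
      rw [abs_mul]
      exact mul_le_of_le_one_left (abs_nonneg _) (hs i j)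
    refine add_le_add ?_ ?_
    · refine (hc i).trans ?_
      simp_rw [← sq]
      rw [abs_of_nonneg (integral_nonneg fun z => sq_nonneg _)]
      exact hχ i hi
    · refine (Finset.sum_le_card_nsmul _ _ κ fun j hj => (hc j).trans
        (hκ i hi j (Finset.mem_of_mem_erase hj) (Finset.ne_of_mem_erase hj).symm)).trans ?_
      rw [nsmul_eq_mul]
      gcongr
      exact Finset.erase_subset _ _
  have hn : (0 : ℝ) < T.card := by exact_mod_cast hne.card_pos
  have h7 : ((T.card : ℝ) * τ) ^ 2 ≤ T.card * (χ + T.card * κ) :=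
    (pow_le_pow_left₀ (by positivity) h1 2).trans (h3.trans h6)
  have h8 : (T.card : ℝ) * (T.card * (τ ^ 2 - κ)) ≤ T.card * χ := by nlinarith
  exact le_of_mul_le_mul_left h8 hn

/-! ### Inliers, outliers and reference as measures -/

/-- When `α² + σ² = 1`, the pair `(u, y)` is Gaussian with unit variances and correlation `α`, so
its joint density is symmetric. This exchanges the law of `y` given `u` with that of `u` given `y`.
-/
lemma gaussianRatio_comm {α σ : ℝ} (hσ : 0 < σ) (hασ : α ^ 2 + σ ^ 2 = 1) (u y : ℝ) :
    gaussianRatio (α * u) σ y = gaussianRatio (α * y) σ u := by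
  unfold gaussianRatio
  congr 2
  have h : α ^ 2 = 1 - σ ^ 2 := by linarith
  have h0 := hσ.ne'
  field_simp
  ring_nf
  rw [h]
  ring

lemma lintegral_gaussianRatio {m σ : ℝ} (hσ : 0 < σ) :
    ∫⁻ u, ENNReal.ofReal (gaussianRatio m σ u) ∂(gaussianReal 0 1) = 1 := by
  rw [← setLIntegral_univ, ← withDensity_apply _ MeasurableSet.univ,
    ← gaussianReal_eq_withDensity hσ, measure_univ]

lemma lintegral_noiseWeight :
    ∫⁻ y, ENNReal.ofReal (noiseWeight y) ∂(gaussianReal 0 1) = 1 := by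
  have hsq : Integrable (fun y : ℝ => y ^ 2) (gaussianReal 0 1) :=
    (memLp_id_gaussianReal (μ := 0) (v := 1) 2).integrable_sq
  have h1 : ∫ y : ℝ, y ^ 2 ∂(gaussianReal 0 1) = 1 := by
    have h := variance_fun_id_gaussianReal (μ := 0) (v := 1)
    rw [variance_of_integral_eq_zero (by fun_prop) integral_id_gaussianReal] at h
    simpa using h
  have hint : Integrable noiseWeight (gaussianReal 0 1) :=
    ((integrable_const 1).add hsq).div_const 2
  rw [← ofReal_integral_eq_lintegral_ofReal hint (.of_forall fun y => (noiseWeight_pos y).le)]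
  unfold noiseWeight
  rw [integral_div, integral_add (integrable_const 1) hsq, h1]
  norm_num

section Measures

variable {d : ℕ}

/-- The standard Gaussian law on `ℝ^d × ℝ`. -/
noncomputable abbrev baseMeasure (d : ℕ) : Measure (EuclideanSpace ℝ (Fin d) × ℝ) :=
  (stdGaussian (EuclideanSpace ℝ (Fin d))).prod (gaussianReal 0 1)

/-- Given `x`, the response is `N(α ⟨v, x⟩, σ²)`. The symmetry of the joint density then expresses
the result as a law of `⟨v, x⟩` given `y`, the form in which the outliers are defined. -/
lemma gaussianRegression_eq_withDensity {α σ : ℝ} (hσ : 0 < σ) (hασ : α ^ 2 + σ ^ 2 = 1)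
    (v : EuclideanSpace ℝ (Fin d)) :
    gaussianRegression (α • v) σ = (baseMeasure d).withDensity
      fun p => ENNReal.ofReal (gaussianRatio (α * p.2) σ (inner ℝ v p.1)) := by
  ext s hs
  have hm : Measurable fun p : EuclideanSpace ℝ (Fin d) × ℝ =>
      (p.1, inner ℝ p.1 (α • v) + p.2) := by fun_prop
  rw [gaussianRegression, Measure.map_apply hm hs, Measure.prod_apply (hm hs),
    withDensity_apply _ hs, ← lintegral_indicator hs, lintegral_prod _ (by
      refine (Measurable.indicator ?_ hs).aemeasurable
      fun_prop)]
  refine lintegral_congr fun x => ?_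
  have hx : MeasurableSet (Prod.mk x ⁻¹' s) := measurable_prodMk_left hs
  have h1 : Prod.mk x ⁻¹' ((fun p : EuclideanSpace ℝ (Fin d) × ℝ =>
      (p.1, inner ℝ p.1 (α • v) + p.2)) ⁻¹' s) =
      (fun y => α * inner ℝ v x + y) ⁻¹' (Prod.mk x ⁻¹' s) := by
    ext y
    simp [real_inner_smul_right, real_inner_comm]
  rw [h1, ← Measure.map_apply (by fun_prop) hx, gaussianReal_map_const_add, zero_add,
    gaussianReal_eq_withDensity hσ, withDensity_apply _ hx, ← lintegral_indicator hx]
  refine lintegral_congr fun y => ?_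
  by_cases hy : (x, y) ∈ s
  · rw [Set.indicator_of_mem (show y ∈ Prod.mk x ⁻¹' s from hy), Set.indicator_of_mem hy,
      gaussianRatio_comm hσ hασ]
  · rw [Set.indicator_of_notMem (show y ∉ Prod.mk x ⁻¹' s from hy), Set.indicator_of_notMem hy]

/-- The law of the outliers. -/
noncomputable def noiseMeasure (α ε : ℝ) (v : EuclideanSpace ℝ (Fin d)) :
    Measure (EuclideanSpace ℝ (Fin d) × ℝ) :=
  (baseMeasure d).withDensity fun p => ENNReal.ofReal
    (noiseWeight p.2 * gaussianRatio (-noiseShift α ε p.2) 1 (inner ℝ v p.1))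

@[fun_prop]
lemma measurable_noiseDensity {α ε : ℝ} (v : EuclideanSpace ℝ (Fin d)) :
    Measurable fun p : EuclideanSpace ℝ (Fin d) × ℝ =>
      noiseWeight p.2 * gaussianRatio (-noiseShift α ε p.2) 1 (inner ℝ v p.1) :=
  (measurable_noiseWeight.comp measurable_snd).mul (measurable_gaussianRatio
    (measurable_noiseShift.comp measurable_snd).neg (by fun_prop))

lemma isProbabilityMeasure_noiseMeasure {α ε : ℝ} {v : EuclideanSpace ℝ (Fin d)}
    (hv : ‖v‖ = 1) : IsProbabilityMeasure (noiseMeasure α ε v) := by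
  refine ⟨?_⟩
  rw [noiseMeasure, withDensity_apply _ MeasurableSet.univ, setLIntegral_univ, lintegral_prod_symm' _ (measurable_noiseDensity v).ennreal_ofReal]
  have h : ∀ y, ∫⁻ x, ENNReal.ofReal (noiseWeight y *
      gaussianRatio (-noiseShift α ε y) 1 (inner ℝ v x))
      ∂(stdGaussian (EuclideanSpace ℝ (Fin d))) = ENNReal.ofReal (noiseWeight y) := by
    intro y
    simp_rw [ENNReal.ofReal_mul (noiseWeight_pos y).le]
    rw [lintegral_const_mul _ (by fun_prop), (measurePreserving_inner hv).lintegral_comp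
      (f := fun u => ENNReal.ofReal (gaussianRatio (-noiseShift α ε y) 1 u)) (by fun_prop),
      lintegral_gaussianRatio one_pos, mul_one]
  simp_rw [h]
  exact lintegral_noiseWeight

lemma isProbabilityMeasure_gaussianRegression (β : EuclideanSpace ℝ (Fin d)) (σ : ℝ) :
    IsProbabilityMeasure (gaussianRegression β σ) :=
  Measure.isProbabilityMeasure_map (by fun_prop)

lemma integral_withDensity_ofReal {Z : Type*} [MeasurableSpace Z] {μ : Measure Z} {h f : Z → ℝ}
    (hm : Measurable h) (h0 : ∀ z, 0 ≤ h z) (hf : Measurable f) (hf1 : ∀ z, |f z| ≤ 1)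
    [IsFiniteMeasure (μ.withDensity fun z => ENNReal.ofReal (h z))] :
    Integrable (fun z => f z * h z) μ ∧
    ∫ z, f z ∂(μ.withDensity fun z => ENNReal.ofReal (h z)) = ∫ z, f z * h z ∂μ := by
  have hint : Integrable f (μ.withDensity fun z => ENNReal.ofReal (h z)) :=
    Integrable.of_bound hf.aestronglyMeasurable 1 (.of_forall hf1)
  rw [integrable_withDensity_iff_integrable_smul' (by fun_prop) (by simp)] at hint
  rw [integral_withDensity_eq_integral_toReal_smul (by fun_prop) (by simp)]
  simp only [ENNReal.toReal_ofReal (h0 _), smul_eq_mul, mul_comm (h _)] at hint ⊢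
  exact ⟨hint, trivial⟩

/-- The reference answers, which do not depend on the hidden direction. -/
noncomputable def referenceAnswer (d : ℕ) (ε : ℝ)
    (q : SQQuery (EuclideanSpace ℝ (Fin d) × ℝ)) : ℝ :=
  ∫ p, q.f p * ((1 - ε) + ε * noiseWeight p.2) ∂(baseMeasure d)

lemma abs_query_le {Z : Type*} [MeasurableSpace Z] (q : SQQuery Z) (z : Z) : |q.f z| ≤ 1 :=
  abs_le.2 (q.f_mem z)

lemma isFiniteMeasure_noiseWeight (d : ℕ) : IsFiniteMeasure ((baseMeasure d).withDensity
    fun p => ENNReal.ofReal (noiseWeight p.2)) := by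
  constructor
  rw [withDensity_apply _ MeasurableSet.univ, setLIntegral_univ, lintegral_prod _ (by
    exact (measurable_noiseWeight.comp measurable_snd).ennreal_ofReal.aemeasurable)]
  simp [lintegral_noiseWeight]

/-- Reduces the question of whether a query distinguishes `v` from the reference to its correlation
with `excess`. -/
lemma integral_mixture_sub_referenceAnswer {α σ ε : ℝ} (hσ : 0 < σ) (hασ : α ^ 2 + σ ^ 2 = 1)
    (hε : 0 < ε) (hε1 : ε < 1) {v : EuclideanSpace ℝ (Fin d)} (hv : ‖v‖ = 1)
    (q : SQQuery (EuclideanSpace ℝ (Fin d) × ℝ)) :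
    ∫ p, q.f p ∂(mixture ε (gaussianRegression (α • v) σ) (noiseMeasure α ε v))
      - referenceAnswer d ε q
      = ∫ p, q.f p * excess α σ ε (inner ℝ v p.1) p.2 ∂(baseMeasure d) := by
  have i1 := isProbabilityMeasure_gaussianRegression (α • v) σ
  have i2 := isProbabilityMeasure_noiseMeasure (α := α) (ε := ε) hv
  have i3 := isFiniteMeasure_noiseWeight d
  have hw : Measurable fun p : EuclideanSpace ℝ (Fin d) × ℝ => noiseWeight p.2 :=
    measurable_noiseWeight.comp measurable_snd
  have hq : ∀ (μ : Measure (EuclideanSpace ℝ (Fin d) × ℝ)) [IsFiniteMeasure μ],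
      Integrable q.f μ := fun μ _ =>
    Integrable.of_bound q.measurable_f.aestronglyMeasurable 1 (.of_forall (abs_query_le q))
  rw [mixture, integral_add_measure ((hq _).smul_measure (by simp))
    ((hq _).smul_measure (by simp)), integral_smul_measure, integral_smul_measure,
    ENNReal.toReal_ofReal (by linarith), ENNReal.toReal_ofReal hε.le]
  rw [gaussianRegression_eq_withDensity hσ hασ] at i1 ⊢
  rw [noiseMeasure] at i2 ⊢
  obtain ⟨a1, e1⟩ := integral_withDensity_ofReal (μ := baseMeasure d)
    (h := fun p => gaussianRatio (α * p.2) σ (inner ℝ v p.1)) (by fun_prop)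
    (fun p => gaussianRatio_nonneg hσ) q.measurable_f (abs_query_le q)
  obtain ⟨a2, e2⟩ := integral_withDensity_ofReal (μ := baseMeasure d)
    (measurable_noiseDensity (α := α) (ε := ε) v)
    (fun p => mul_nonneg (noiseWeight_pos p.2).le (gaussianRatio_nonneg one_pos))
    q.measurable_f (abs_query_le q)
  obtain ⟨a3, -⟩ := integral_withDensity_ofReal (μ := baseMeasure d)
    hw (fun p => (noiseWeight_pos p.2).le) q.measurable_f (abs_query_le q)
  have a4 : Integrable (fun p => q.f p * ((1 - ε) + ε * noiseWeight p.2)) (baseMeasure d) :=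
    (((hq (baseMeasure d)).const_mul (1 - ε)).add (a3.const_mul ε)).congr
      (.of_forall fun p => by simp only [Pi.add_apply]; ring)
  have a5 : Integrable (fun p => (1 - ε) * (q.f p * gaussianRatio (α * p.2) σ (inner ℝ v p.1))
      + ε * (q.f p * (noiseWeight p.2 * gaussianRatio (-noiseShift α ε p.2) 1 (inner ℝ v p.1))))
      (baseMeasure d) := (a1.const_mul _).add (a2.const_mul _)
  rw [e1, e2, referenceAnswer, smul_eq_mul, smul_eq_mul, ← integral_const_mul,
    ← integral_const_mul, ← integral_add (a1.const_mul _) (a2.const_mul _),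
    ← integral_sub a5 a4]
  refine integral_congr_ae (.of_forall fun p => ?_)
  simp only [excess]
  ring

end Measures

/-! ### From a family of directions to the lower bound -/

open Classical in
/-- The lower bound, for hidden directions in a finite set of unit vectors such that every query
distinguishes few of them from the reference. -/
theorem lower_bound_of_family {k d : ℕ} {ε α σ τ N M : ℝ} (hε : 0 < ε) (hε1 : ε < 1 / 2)
    (hσ : 0 < σ) (hασ : α ^ 2 + σ ^ 2 = 1) (hα0 : 1 / 20 ≤ α)
    (V : Finset (EuclideanSpace ℝ (Fin d)))
    (hV : ∀ v ∈ V, (∀ a : ℝ, IsSparse k (a • v)) ∧ ‖v‖ = 1)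
    (hsep : ∀ v ∈ V, ∀ v' ∈ V, v ≠ v' → 1 ≤ ‖v - v'‖)
    (hM : ∀ f : EuclideanSpace ℝ (Fin d) × ℝ → ℝ, Measurable f → (∀ p, |f p| ≤ 1) →
      ((V.filter fun v => τ <
        |∫ p, f p * excess α σ ε (inner ℝ v p.1) p.2 ∂(baseMeasure d)|).card : ℝ) ≤ M)
    (hM0 : 0 ≤ M) (hN : 0 ≤ N) (hcard : 1 + N * M < 2 / 3 * V.card) :
    ∃ (B : Set (EuclideanSpace ℝ (Fin d)))
        (Q : EuclideanSpace ℝ (Fin d) → Measure (EuclideanSpace ℝ (Fin d) × ℝ)),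
        (∀ β ∈ B, IsSparse k β ∧ ‖β‖ ≤ 1) ∧
        (∀ β ∈ B, IsProbabilityMeasure (Q β)) ∧
        ∀ (Ω : Type) [MeasurableSpace Ω] (P : Measure Ω) [IsProbabilityMeasure P]
          (A : Ω → SQAlgorithm (EuclideanSpace ℝ (Fin d) × ℝ) (EuclideanSpace ℝ (Fin d))),
          (∀ β ∈ B, Estimates P A (mixture ε (gaussianRegression β σ) (Q β)) β (1 / 10 ^ 5)) →
          ∃ β ∈ B, ∃ O : SQQuery (EuclideanSpace ℝ (Fin d) × ℝ) → ℝ,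
            IsSTATOracle (mixture ε (gaussianRegression β σ) (Q β)) O ∧
            0 < P {ω | N ≤ (((A ω).queries O).length : ℝ) ∨ ∃ q ∈ (A ω).queries O, q.tol < τ} := by
  have hα : 0 < α := by linarith
  have hinj : Function.Injective fun v : EuclideanSpace ℝ (Fin d) => α • v :=
    smul_right_injective _ hα.ne'
  have hinv : ∀ v : EuclideanSpace ℝ (Fin d), α⁻¹ • α • v = v := inv_smul_smul₀ hα.ne'
  let B := V.image fun v => α • v
  -- The outlier law is indexed by `β`, from which the direction is recovered as `α⁻¹ • β`.
  refine ⟨B, fun β => noiseMeasure α ε (α⁻¹ • β), ?_, ?_, ?_⟩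
  · intro β hβ
    obtain ⟨v, hv, rfl⟩ := Finset.mem_image.1 (Finset.mem_coe.1 hβ)
    refine ⟨(hV v hv).1 α, ?_⟩
    rw [norm_smul, (hV v hv).2, mul_one, Real.norm_of_nonneg hα.le]
    nlinarith
  · intro β hβ
    obtain ⟨v, hv, rfl⟩ := Finset.mem_image.1 (Finset.mem_coe.1 hβ)
    simp only [hinv]
    exact isProbabilityMeasure_noiseMeasure (hV v hv).2
  · intro Ω _ P _ A hest
    by_contra hcon
    push Not at hcon
    have key := two_thirds_card_le P A B
      (fun β => mixture ε (gaussianRegression β σ) (noiseMeasure α ε (α⁻¹ • β)))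
      (referenceAnswer d ε) (δ := 1 / 10 ^ 5) (τ := τ) (M := M) (N := N) ?_ ?_ hM0 hN hest
      (fun β hβ O hO => le_antisymm (hcon β hβ O hO) bot_le)
    · rw [Finset.card_image_of_injective _ hinj] at key
      linarith
    · intro β hβ β' hβ' hne
      obtain ⟨v, hv, rfl⟩ := Finset.mem_image.1 hβ
      obtain ⟨v', hv', rfl⟩ := Finset.mem_image.1 hβ'
      -- Distinct parameters are at distance at least `α ≥ 1/20`, more than twice the accuracy
      -- `10⁻⁵`.
      have h := hsep v hv v' hv' fun h => hne (by rw [h])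
      rw [← smul_sub, norm_smul, Real.norm_of_nonneg hα.le]
      nlinarith
    · intro q hq
      refine le_trans ?_ (hM q.f q.measurable_f (abs_query_le q))
      rw [Finset.filter_image, Finset.card_image_of_injective _ hinj, Nat.cast_le]
      refine Finset.card_le_card fun v hv => ?_
      rw [Finset.mem_filter] at hv ⊢
      refine ⟨hv.1, hq.trans_lt ?_⟩
      have h := hv.2
      rw [hinv, abs_sub_comm, integral_mixture_sub_referenceAnswer hσ hασ hε (by linarith)
        (hV v hv.1).2] at h
      exact h

/-- A bounded query distinguishes few of a family of almost orthogonal hidden directions. -/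
lemma card_distinguished_le {d : ℕ} {α σ ε τ r : ℝ} (hσ : 0 < σ) (hασ : α ^ 2 + σ ^ 2 = 1)
    (hα0 : 0 ≤ α) (hα : α ≤ 1 / 10) (hε : 0 < ε) (hε1 : ε < 1) (hτ : 0 ≤ τ)
    (V : Finset (EuclideanSpace ℝ (Fin d))) (hV : ∀ v ∈ V, ‖v‖ = 1)
    (hr : ∀ v ∈ V, ∀ v' ∈ V, v ≠ v' → |inner ℝ v v'| ≤ r)
    {f : EuclideanSpace ℝ (Fin d) × ℝ → ℝ} (hf : Measurable f) (hf1 : ∀ p, |f p| ≤ 1)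
    (hT : ∀ v ∈ V, τ ≤ |∫ p, f p * excess α σ ε (inner ℝ v p.1) p.2 ∂(baseMeasure d)|) :
    (V.card : ℝ) * (τ ^ 2 - r ^ 2 * (280 * Real.exp (1 / ε ^ 2))) ≤
      280 * Real.exp (1 / ε ^ 2) := by
  have h1 : ∀ v ∈ V, MemLp (fun p => excess α σ ε (inner ℝ v p.1) p.2) 2 (baseMeasure d) :=
    fun v hv => memLp_excess_inner hσ hασ hα0 hα hε hε1 (hV v hv)
  have h2 : ∀ v ∈ V, ∫ p, excess α σ ε (inner ℝ v p.1) p.2 ^ 2 ∂(baseMeasure d) ≤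
      280 * Real.exp (1 / ε ^ 2) :=
    fun v hv => integral_sq_excess_inner_le hσ hασ hα0 hα hε hε1 (hV v hv)
  have h3 : ∀ v ∈ V, ∀ v' ∈ V, v ≠ v' → |∫ p, excess α σ ε (inner ℝ v p.1) p.2 *
      excess α σ ε (inner ℝ v' p.1) p.2 ∂(baseMeasure d)| ≤
      r ^ 2 * (280 * Real.exp (1 / ε ^ 2)) := fun v hv v' hv' hne => by
    refine (abs_integral_excess_mul_excess_le hσ hασ hα0 hα hε hε1 (hV v hv) (hV v' hv')).trans
      (mul_le_mul_of_nonneg_right ?_ (by positivity))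
    exact sq_le_sq.2 ((hr v hv v' hv' hne).trans (le_abs_self r))
  have h4 : 0 ≤ r ^ 2 * (280 * Real.exp (1 / ε ^ 2)) := by positivity
  have h5 := card_mul_sub_le (μ := baseMeasure d) (χ := 280 * Real.exp (1 / ε ^ 2))
    (κ := r ^ 2 * (280 * Real.exp (1 / ε ^ 2))) (τ := τ)
    (F := fun v p => excess α σ ε (inner ℝ v p.1) p.2) hf hf1 V h1 hτ hT h2 h4 h3
  rcases h5 with h | h
  · exact h
  · rw [h]
    simp only [Finset.card_empty, Nat.cast_zero, zero_mul]
    positivity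

end RobustSparseSQ

/-! ### Choice of constants and conclusion -/

open RobustSparseSQ in
theorem mainTheorem5 :
    ∃ C : ℝ, 0 < C ∧ ∀ (k d : ℕ) (ε c : ℝ), 1 ≤ k → (k : ℝ) ≤ Real.sqrt d →
      0 < ε → ε < 1 / 2 → 0 < c → c < 1 →
      ∃ (B : Set (EuclideanSpace ℝ (Fin d))) (σ : ℝ)
        (Q : EuclideanSpace ℝ (Fin d) → Measure (EuclideanSpace ℝ (Fin d) × ℝ)),
        (∀ β ∈ B, RobustSparseSQ.IsSparse k β ∧ ‖β‖ ≤ 1) ∧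
        0.99 ≤ σ ∧ σ ≤ 1 ∧
        (∀ β ∈ B, IsProbabilityMeasure (Q β)) ∧
        ∀ (Ω : Type) [MeasurableSpace Ω] (P : Measure Ω) [IsProbabilityMeasure P]
          (A : Ω → RobustSparseSQ.SQAlgorithm (EuclideanSpace ℝ (Fin d) × ℝ)
            (EuclideanSpace ℝ (Fin d))),
          (∀ β ∈ B, RobustSparseSQ.Estimates P A
            (RobustSparseSQ.mixture ε (RobustSparseSQ.gaussianRegression β σ) (Q β)) β
            (1 / 10 ^ 5)) →
          ∃ β ∈ B, ∃ O : RobustSparseSQ.SQQuery (EuclideanSpace ℝ (Fin d) × ℝ) → ℝ,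
            RobustSparseSQ.IsSTATOracle
              (RobustSparseSQ.mixture ε (RobustSparseSQ.gaussianRegression β σ) (Q β)) O ∧
            0 < P {ω |
              (d : ℝ) ^ (c * (k : ℝ) ^ c / 8) * (k : ℝ) ^ (-2 + 2 * c)
                  ≤ (((A ω).queries O).length : ℝ) ∨
              ∃ q ∈ (A ω).queries O,
                q.tol < (k : ℝ) ^ (-1 + c) * Real.exp (C / ε ^ 2)} := by
  -- With `X = exp (1/ε²)` and `C = 10`, the squared tolerance is `r² X²⁰`, to be compared with `280
  -- X` and `280 r² X`.
  refine ⟨10, by norm_num, fun k d ε c hk hkd hε hε1 hc0 hc1 => ?_⟩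
  classical
  have hk0 : (0 : ℝ) < k := by positivity
  obtain ⟨X, hX⟩ : ∃ X, X = Real.exp (1 / ε ^ 2) := ⟨_, rfl⟩
  obtain ⟨r, hr⟩ : ∃ r, r = (k : ℝ) ^ (-1 + c) := ⟨_, rfl⟩
  have hX5 : 5 ≤ X := by
    have h1 : (4 : ℝ) ≤ 1 / ε ^ 2 := by
      rw [le_div_iff₀ (by positivity)]
      nlinarith
    have h2 := Real.add_one_le_exp (1 / ε ^ 2)
    rw [hX]
    linarith
  -- `3080 = 2800 + 280`: after subtracting the correlation term `280 X`, at least `2800 X` remains,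
  -- ten times the second-moment bound.
  have hX20 : 3080 * X ≤ X ^ 20 := by
    have h1 : (5 : ℝ) ^ 19 ≤ X ^ 19 := by gcongr
    rw [pow_succ]
    have h2 : (3080 : ℝ) ≤ X ^ 19 := le_trans (by norm_num) h1
    gcongr
  have hr0 : 0 < r := by rw [hr]; exact Real.rpow_pos_of_pos hk0 _
  have hC : Real.exp (10 / ε ^ 2) = X ^ 10 := by
    rw [hX, ← Real.exp_nat_mul]
    congr 1
    push_cast
    ring
  have hr2 : (k : ℝ) ^ (-2 + 2 * c) = r ^ 2 := by
    rw [hr, ← Real.rpow_natCast, ← Real.rpow_mul hk0.le]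
    congr 1
    push_cast
    ring
  have hτ2 : (r * X ^ 10) ^ 2 = r ^ 2 * X ^ 20 := by ring
  rw [hC, hr2, ← hr]
  -- The triple `40² + 399² = 401²` gives rational values with `1/20 ≤ α ≤ 1/10` and `σ ≥ 0.99`.
  have hσ : (0 : ℝ) < 399 / 401 := by norm_num
  have hασ : (40 / 401 : ℝ) ^ 2 + (399 / 401) ^ 2 = 1 := by norm_num
  have hN : 0 ≤ (d : ℝ) ^ (c * (k : ℝ) ^ c / 8) * r ^ 2 := by positivity
  suffices h : ∃ (V : Finset (EuclideanSpace ℝ (Fin d))) (M : ℝ),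
      (∀ v ∈ V, (∀ a : ℝ, IsSparse k (a • v)) ∧ ‖v‖ = 1) ∧
      (∀ v ∈ V, ∀ v' ∈ V, v ≠ v' → 1 ≤ ‖v - v'‖) ∧
      (∀ f : EuclideanSpace ℝ (Fin d) × ℝ → ℝ, Measurable f → (∀ p, |f p| ≤ 1) →
        ((V.filter fun v => r * X ^ 10 < |∫ p, f p *
          excess (40 / 401) (399 / 401) ε (inner ℝ v p.1) p.2 ∂(baseMeasure d)|).card : ℝ) ≤ M) ∧
      0 ≤ M ∧ 1 + (d : ℝ) ^ (c * (k : ℝ) ^ c / 8) * r ^ 2 * M < 2 / 3 * V.card by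
    obtain ⟨V, M, hV, hsep, hM, hM0, hcard⟩ := h
    obtain ⟨B, Q, hB, hQ, h⟩ := lower_bound_of_family hε hε1 hσ hασ (by norm_num) V hV hsep
      (fun f hf hf1 => by convert hM f hf hf1) hM0 hN hcard
    exact ⟨B, 399 / 401, Q, hB, by norm_num, by norm_num, hQ, h⟩
  -- If the squared tolerance exceeds the second moment of the perturbation, no admissible query
  -- distinguishes any direction from the reference. Two opposite vectors then suffice, with `M =
  -- 0`. This includes `k = 1`, where `r = 1`.
  by_cases hcase : 280 * X < r ^ 2 * X ^ 20
  · have hd : 0 < d := by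
      rcases Nat.eq_zero_or_pos d with rfl | h
      · simp only [CharP.cast_eq_zero, Real.sqrt_zero] at hkd
        linarith
      · exact h
    let e : EuclideanSpace ℝ (Fin d) := EuclideanSpace.single ⟨0, hd⟩ 1
    have he : ‖e‖ = 1 := by simp [e]
    have hsparse : ∀ a : ℝ, IsSparse k (a • e) := by
      intro a
      refine le_trans (Set.ncard_le_ncard (t := {⟨0, hd⟩}) ?_) (by simpa using hk)
      intro i hi
      by_contra hne
      have hne' : i ≠ ⟨0, hd⟩ := hne
      refine hi ?_
      simp [e, hne']
    have h2 : ‖e - -e‖ = 2 := by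
      rw [sub_neg_eq_add, ← two_smul ℝ e, norm_smul, he]
      norm_num
    have hne : e ≠ -e := fun h => by
      rw [← h, sub_self, norm_zero] at h2
      norm_num at h2
    have hV : ∀ v ∈ ({e, -e} : Finset (EuclideanSpace ℝ (Fin d))),
        (∀ a : ℝ, IsSparse k (a • v)) ∧ ‖v‖ = 1 := by
      simp only [Finset.mem_insert, Finset.mem_singleton, forall_eq_or_imp, forall_eq, norm_neg]
      exact ⟨⟨hsparse, he⟩, fun a => by simpa using hsparse (-a), he⟩
    refine ⟨{e, -e}, 0, hV, ?_, ?_, le_rfl, ?_⟩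
    · simp only [Finset.mem_insert, Finset.mem_singleton]
      rintro v (rfl | rfl) v' (rfl | rfl) h
      · exact absurd rfl h
      · rw [h2]; norm_num
      · rw [norm_sub_rev, h2]; norm_num
      · exact absurd rfl h
    · intro f hf hf1
      rw [Finset.filter_false_of_mem]
      · simp
      · intro v hv hlt
        -- A one-element family has no pairs, so `r = 0` is allowed and the bound reads `τ² ≤ 280
        -- X`, contradicting the case assumption.
        have h := card_distinguished_le (τ := r * X ^ 10) (r := 0) hσ hασ (by norm_num)
          (by norm_num) hε (by linarith) (by positivity) {v} (by simpa using (hV v hv).2)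
          (by simp) hf hf1 (by simpa using hlt.le)
        rw [hτ2, ← hX] at h
        simp only [Finset.card_singleton, Nat.cast_one] at h
        linarith
    · rw [Finset.card_pair hne]
      norm_num
  · have hr4 : r ^ 2 ≤ 1 / 4 := by
      by_contra h
      rw [not_le] at h
      have : 1 / 4 * X ^ 20 ≤ r ^ 2 * X ^ 20 := by gcongr
      linarith
    have hrhalf : r ≤ 1 / 2 := by nlinarith
    have hk2 : 2 ≤ k := by
      by_contra h
      have : k = 1 := by omega
      rw [this, Nat.cast_one, Real.one_rpow] at hr
      linarith
    obtain ⟨V, hV, hVr, hV2, hVd⟩ := exists_sparse_family hk2 hkd hc0 hc1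
    rw [← hr] at hVr
    -- With this `M`, the factor `r²` in the number of queries cancels and `N * M = d ^ (c k ^ c /
    -- 8) / 10 ≤ |V| / 10`. Since `|V| ≥ 2`, `1 + |V| / 10` is below `2/3 |V|`.
    refine ⟨V, 1 / (10 * r ^ 2), hV, ?_, ?_, by positivity, ?_⟩
    · intro v hv v' hv' hne
      have h1 := (abs_le.1 (hVr v hv v' hv' hne)).2
      have h2 : (1 : ℝ) ^ 2 ≤ ‖v - v'‖ ^ 2 := by
        rw [norm_sub_sq_real, (hV v hv).2, (hV v' hv').2]
        linarith
      exact le_of_sq_le_sq h2 (norm_nonneg _)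
    · intro f hf hf1
      have h := card_distinguished_le (τ := r * X ^ 10) (r := r) hσ hασ (by norm_num)
        (by norm_num) hε (by linarith) (by positivity)
        (V.filter fun v => r * X ^ 10 < |∫ p, f p *
          excess (40 / 401) (399 / 401) ε (inner ℝ v p.1) p.2 ∂(baseMeasure d)|)
        (fun v hv => (hV v (Finset.mem_filter.1 hv).1).2)
        (fun v hv v' hv' => hVr v (Finset.mem_filter.1 hv).1 v' (Finset.mem_filter.1 hv').1)
        hf hf1 (fun v hv => (Finset.mem_filter.1 hv).2.le)
      rw [hτ2, ← hX, ← mul_sub] at h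
      rw [le_div_iff₀ (by positivity)]
      have h3 : r ^ 2 * (2800 * X) ≤ r ^ 2 * (X ^ 20 - 280 * X) := by
        gcongr
        linarith
      have h4 := (mul_le_mul_of_nonneg_left h3 (Nat.cast_nonneg _)).trans h
      refine le_of_mul_le_mul_right (le_trans (le_of_eq ?_) (h4.trans (le_of_eq ?_)))
        (show 0 < 280 * X by positivity)
      · ring
      · ring
    · have h5 : (d : ℝ) ^ (c * (k : ℝ) ^ c / 8) * r ^ 2 * (1 / (10 * r ^ 2)) =
          (d : ℝ) ^ (c * (k : ℝ) ^ c / 8) / 10 := by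
        field_simp
      have h6 : (2 : ℝ) ≤ V.card := by exact_mod_cast hV2
      rw [h5]
      linarith
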